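/- Let $M,a\in\mathbb R$ and consider the Kerr metric of signature $(-,+,+,+)$ ($c=G=1$) in Boyer–Lindquist coordinates $(t,r,\theta,\varphi)$, $$ds^2=-\Big(1-\tfrac{2Mr}{\Sigma}\Big)dt^2-\tfrac{4Mar\sin^2\theta}{\Sigma}\,dt\,d\varphi+\tfrac{\Sigma}{\Delta}dr^2+\Sigma\, d\theta^2+\Big(r^2+a^2+\tfrac{2Ma^2r\sin^2\theta}{\Sigma}\Big)\sin^2\theta\, d\varphi^2,$$ $\Sigma=r^2+a^2\cos^2\theta$, $\Delta=r^2-2Mr+a^2$, at a point with $\Sigma\ne0$, $\Delta\neq0$, $\sin\theta\ne0$. A tuple $(W,X,Y,Z,\sigma)$ of real tangent vectors and a real number solves the singular value problem (SVP) if $R(Y,Z)X=\sigma W$, $R(Z,Y)W=\sigma X$, $R(W,X)Z=\sigma Y$, $R(X,W)Y=\sigma Z$ and $\langle W,W\rangle=\langle X,X\rangle=\langle Y,Y\rangle=\langle Z,Z\rangle=1$, where $R(X,Y)=[\nabla_X,\nabla_Y]-\nabla_{[X,Y]}$. Put $$l=\tfrac1\Delta(r^2+a^2,\Delta,0,a),\quad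 n=\tfrac1{2\Sigma}(r^2+a^2,-\Delta,0,a),\quad m=\tfrac{1}{\sqrt2(r+ia\cos\theta)}\big(ia\sin\theta,0,1,\tfrac{i}{\sin\theta}\big).$$ With $C$ the Weyl tensor, $C(\partial_i,\partial_j,\partial_k,\partial_h)=C_{ijkh}$, and indices of the Riemann tensor ordered so that $R_{ijkh}=\langle\partial_i,R(\partial_k,\partial_h)\partial_j\rangle$, let $\Psi_0=-C(l,m,l,m)$, $\Psi_1=-C(l,n,l,m)$, $\Psi_2=-C(l,m,\bar m,n)$, $\Psi_3=-C(l,n,\bar m,n)$, $\Psi_4=-C(n,\bar m,n,\bar m)$ and $I=\Psi_0\Psi_4-4\Psi_1\Psi_3+3\Psi_2^2$. Then: 1. $(l,n,m,\bar m)$ is a Newman–Penrose null tetrad ($\langle l,n\rangle=-1$, $\langle m,\bar m\rangle=1$, all other products $0$), $\Psi_0=\Psi_1=\Psi_3=\Psi_4=0$ and $\Psi_2=\dfrac{M}{(r-ia\cos\theta)^3}$. 2. Consider the ansatz $X=x^1l+x^2n+x^3m+x^4\bar m$, $Y=x^1l+x^2n-x^3m-x^4\bar m$, $Z=X$, $W=-Y$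 with real vectors $X,Y$ and $X\neq\pm Y$. Then $(W,X,Y,Z,\sigma)$ solves the SVP if and only if $$2x^3x^4(\Psi_2+\bar\Psi_2)-\sigma=0,\qquad 2x^1x^2(\Psi_2+\bar\Psi_2)+\sigma=0,\qquad -2x^1x^2+2x^3x^4=1.$$ 3. For every solution of the SVP of this form, $$\sigma=\frac{(r^3-3ra^2\cos^2\theta)M}{(r^2+a^2\cos^2\theta)^3},\qquad |\sigma|=\sqrt{\frac{|I|+\operatorname{Re}I}{6}},$$ so that $\sigma$ equals the square root whenever $(r^3-3ra^2\cos^2\theta)M\ge0$. If $a=0$ (Schwarzschild), then $I=3M^2/r^6$ and $\sigma=M/r^3$. 4. Such solutions exist, and for some of them $\sqrt{(|I|+\operatorname{Re}I)/6}$ is also a singular value, with the vectors $(W,X,Y,Z)$ or $(-W,X,Y,Z)$. -/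

import Mathlib

namespace KerrSVP

noncomputable section

/-! Pseudo-Riemannian curvature in a chart of dimension four.  A metric is given by its matrix of
components `g p i j` at the point `p` of the chart. -/

/-- Partial derivative `∂_k f` at `p`. -/
def pderiv (k : Fin 4) (f : (Fin 4 → ℝ) → ℝ) (p : Fin 4 → ℝ) : ℝ :=
  deriv (fun s => f (Function.update p k s)) (p k)

/-- Christoffel symbols `Γ^i_{jk}` of the Levi-Civita connection. -/
def christoffel (g : (Fin 4 → ℝ) → Matrix (Fin 4) (Fin 4) ℝ) (i j k : Fin 4)
    (p : Fin 4 → ℝ) : ℝ :=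
  (1 / 2) * ∑ m, (g p)⁻¹ i m *
    (pderiv j (fun q => g q m k) p + pderiv k (fun q => g q m j) p - pderiv m (fun q => g q j k) p)

/-- `R^i_{jkl}`, defined by `R(∂_k, ∂_l) ∂_j = R^i_{jkl} ∂_i` with
`R(X, Y) = [∇_X, ∇_Y] - ∇_{[X, Y]}`. -/
def riemannUp (g : (Fin 4 → ℝ) → Matrix (Fin 4) (Fin 4) ℝ) (p : Fin 4 → ℝ)
    (i j k l : Fin 4) : ℝ :=
  pderiv k (christoffel g i l j) p - pderiv l (christoffel g i k j) p
    + ∑ m, christoffel g m l j p * christoffel g i k m p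
    - ∑ m, christoffel g m k j p * christoffel g i l m p

/-- `R_{ijkl} = g_{ih} R^h_{jkl}`. -/
def riemannDown (g : (Fin 4 → ℝ) → Matrix (Fin 4) (Fin 4) ℝ) (p : Fin 4 → ℝ)
    (i j k l : Fin 4) : ℝ :=
  ∑ h, g p i h * riemannUp g p h j k l

/-- Ricci tensor `R_{ik} = R^m_{imk}`. -/
def ricci (g : (Fin 4 → ℝ) → Matrix (Fin 4) (Fin 4) ℝ) (p : Fin 4 → ℝ) (i k : Fin 4) : ℝ :=
  ∑ m, riemannUp g p m i m k

/-- Ricci scalar `g^{ik} R_{ik}`. -/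
def ricciScalar (g : (Fin 4 → ℝ) → Matrix (Fin 4) (Fin 4) ℝ) (p : Fin 4 → ℝ) : ℝ :=
  ∑ i, ∑ k, (g p)⁻¹ i k * ricci g p i k

/-- Weyl tensor `C_{ijkl}` in dimension four. -/
def weyl (g : (Fin 4 → ℝ) → Matrix (Fin 4) (Fin 4) ℝ) (p : Fin 4 → ℝ) (i j k l : Fin 4) : ℝ :=
  riemannDown g p i j k l
    + (1 / 2) * (ricci g p i l * g p j k - ricci g p i k * g p j l
        + g p i l * ricci g p j k - g p i k * ricci g p j l)
    - (ricciScalar g p / 6) * (g p i l * g p j k - g p i k * g p j l)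

/-- Inner product `⟨X, Y⟩ = g_{ij} x^i y^j` of tangent vectors at `p`. -/
def inner4 (g : (Fin 4 → ℝ) → Matrix (Fin 4) (Fin 4) ℝ) (p X Y : Fin 4 → ℝ) : ℝ :=
  ∑ i, ∑ j, g p i j * X i * Y j

/-- The curvature operator: `curvOp g p Y Z X` is the vector `R(Y, Z) X`, with components
`R^i_{jkl} x^j y^k z^l`. -/
def curvOp (g : (Fin 4 → ℝ) → Matrix (Fin 4) (Fin 4) ℝ) (p Y Z X : Fin 4 → ℝ) : Fin 4 → ℝ :=
  fun i => ∑ j, ∑ k, ∑ l, riemannUp g p i j k l * X j * Y k * Z l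

/-- `(W, X, Y, Z, σ)` solves the singular value problem of the Riemann tensor of `g` at `p`. -/
structure IsSVP (g : (Fin 4 → ℝ) → Matrix (Fin 4) (Fin 4) ℝ) (p : Fin 4 → ℝ)
    (W X Y Z : Fin 4 → ℝ) (σ : ℝ) : Prop where
  eqW : curvOp g p Y Z X = σ • W
  eqX : curvOp g p Z Y W = σ • X
  eqY : curvOp g p W X Z = σ • Y
  eqZ : curvOp g p X W Y = σ • Z
  normW : inner4 g p W W = 1
  normX : inner4 g p X X = 1
  normY : inner4 g p Y Y = 1
  normZ : inner4 g p Z Z = 1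

/-! Newman–Penrose formalism. -/

/-- A real vector regarded as a complex vector. -/
def toC (X : Fin 4 → ℝ) : Fin 4 → ℂ := fun i => (X i : ℂ)

/-- Complex bilinear extension of the metric at `p`. -/
def innerC (g : (Fin 4 → ℝ) → Matrix (Fin 4) (Fin 4) ℝ) (p : Fin 4 → ℝ) (u v : Fin 4 → ℂ) : ℂ :=
  ∑ i, ∑ j, (g p i j : ℂ) * u i * v j

/-- Complex multilinear extension of the Weyl tensor at `p`. -/
def weylC (g : (Fin 4 → ℝ) → Matrix (Fin 4) (Fin 4) ℝ) (p : Fin 4 → ℝ)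
    (u v w z : Fin 4 → ℂ) : ℂ :=
  ∑ i, ∑ j, ∑ k, ∑ l, (weyl g p i j k l : ℂ) * u i * v j * w k * z l

/-- The vectors `l`, `n` (real), `m` (complex) at a point; the fourth vector is the complex
conjugate `m̄ = star m`. -/
structure Tetrad where
  l : Fin 4 → ℝ
  n : Fin 4 → ℝ
  m : Fin 4 → ℂ

/-- The complex frame `(l, n, m, m̄)`. -/
def Tetrad.frame (T : Tetrad) : Fin 4 → Fin 4 → ℂ := ![toC T.l, toC T.n, T.m, star T.m]

/-- Newman–Penrose null tetrad for signature `(-,+,+,+)`: `⟨l, n⟩ = -1`, `⟨m, m̄⟩ = 1` and all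
other inner products of frame vectors vanish. -/
def Tetrad.IsNull (T : Tetrad) (g : (Fin 4 → ℝ) → Matrix (Fin 4) (Fin 4) ℝ)
    (p : Fin 4 → ℝ) : Prop :=
  ∀ A B, innerC g p (T.frame A) (T.frame B) =
    (!![0, -1, 0, 0; -1, 0, 0, 0; 0, 0, 0, 1; 0, 0, 1, 0] : Matrix (Fin 4) (Fin 4) ℂ) A B

/-! The Weyl scalars `Ψ₀, …, Ψ₄`. -/

def psi0 (g : (Fin 4 → ℝ) → Matrix (Fin 4) (Fin 4) ℝ) (p : Fin 4 → ℝ) (T : Tetrad) : ℂ :=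
  -weylC g p (toC T.l) T.m (toC T.l) T.m

def psi1 (g : (Fin 4 → ℝ) → Matrix (Fin 4) (Fin 4) ℝ) (p : Fin 4 → ℝ) (T : Tetrad) : ℂ :=
  -weylC g p (toC T.l) (toC T.n) (toC T.l) T.m

def psi2 (g : (Fin 4 → ℝ) → Matrix (Fin 4) (Fin 4) ℝ) (p : Fin 4 → ℝ) (T : Tetrad) : ℂ :=
  -weylC g p (toC T.l) T.m (star T.m) (toC T.n)

def psi3 (g : (Fin 4 → ℝ) → Matrix (Fin 4) (Fin 4) ℝ) (p : Fin 4 → ℝ) (T : Tetrad) : ℂ :=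
  -weylC g p (toC T.l) (toC T.n) (star T.m) (toC T.n)

def psi4 (g : (Fin 4 → ℝ) → Matrix (Fin 4) (Fin 4) ℝ) (p : Fin 4 → ℝ) (T : Tetrad) : ℂ :=
  -weylC g p (toC T.n) (star T.m) (toC T.n) (star T.m)

/-- The invariant `I = Ψ₀Ψ₄ - 4Ψ₁Ψ₃ + 3Ψ₂²`. -/
def invI (g : (Fin 4 → ℝ) → Matrix (Fin 4) (Fin 4) ℝ) (p : Fin 4 → ℝ) (T : Tetrad) : ℂ :=
  psi0 g p T * psi4 g p T - 4 * psi1 g p T * psi3 g p T + 3 * psi2 g p T ^ 2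

/-- The special ansatz: `X = c₀ l + c₁ n + c₂ m + c₃ m̄`, `Y = c₀ l + c₁ n - c₂ m - c₃ m̄`,
`Z = X`, `W = -Y`, where `W, X, Y, Z` are real tangent vectors. -/
structure Tetrad.Ansatz (T : Tetrad) (c : Fin 4 → ℂ) (W X Y Z : Fin 4 → ℝ) : Prop where
  hX : toC X = ∑ A, c A • T.frame A
  hY : toC Y = ∑ A, (![c 0, c 1, -c 2, -c 3] : Fin 4 → ℂ) A • T.frame A
  hZ : Z = X
  hW : W = -Y

/-! The Kerr metric in Boyer–Lindquist coordinates `p = (t, r, θ, φ)`. -/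

/-- `Σ = r² + a² cos² θ`. -/
def kSigma (a : ℝ) (p : Fin 4 → ℝ) : ℝ := p 1 ^ 2 + a ^ 2 * Real.cos (p 2) ^ 2

/-- `Δ = r² - 2 M r + a²`. -/
def kDelta (M a : ℝ) (p : Fin 4 → ℝ) : ℝ := p 1 ^ 2 - 2 * M * p 1 + a ^ 2

/-- Components of the Kerr metric, signature `(-,+,+,+)`, `c = G = 1`. -/
def kerrMetric (M a : ℝ) (p : Fin 4 → ℝ) : Matrix (Fin 4) (Fin 4) ℝ :=
  !![-(1 - 2 * M * p 1 / kSigma a p), 0, 0,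
        -(2 * M * a * p 1 * Real.sin (p 2) ^ 2 / kSigma a p);
     0, kSigma a p / kDelta M a p, 0, 0;
     0, 0, kSigma a p, 0;
     -(2 * M * a * p 1 * Real.sin (p 2) ^ 2 / kSigma a p), 0, 0,
        (p 1 ^ 2 + a ^ 2 + 2 * M * a ^ 2 * p 1 * Real.sin (p 2) ^ 2 / kSigma a p)
          * Real.sin (p 2) ^ 2]

/-- Where `r² - 2Mr + a² cos² θ ≠ 0`, the line element is
`-f (dt + k dφ)² + f⁻¹ [Δ sin² θ dφ² + (r² - 2Mr + a² cos² θ) (dr² / Δ + dθ²)]` with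
`f = 1 - 2Mr / Σ` and `k = 2Mar sin² θ / (r² - 2Mr + a² cos² θ)`.  The components above have no
singularity at `r² - 2Mr + a² cos² θ = 0`. -/
theorem kerrMetric_lineElement (M a : ℝ) (p v : Fin 4 → ℝ) (hS : kSigma a p ≠ 0)
    (hD : kDelta M a p ≠ 0) (hE : p 1 ^ 2 - 2 * M * p 1 + a ^ 2 * Real.cos (p 2) ^ 2 ≠ 0) :
    inner4 (kerrMetric M a) p v v =
      -(1 - 2 * M * p 1 / kSigma a p) *
          (v 0 + 2 * M * a * p 1 * Real.sin (p 2) ^ 2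
            / (p 1 ^ 2 - 2 * M * p 1 + a ^ 2 * Real.cos (p 2) ^ 2) * v 3) ^ 2
        + (1 - 2 * M * p 1 / kSigma a p)⁻¹ *
          (kDelta M a p * Real.sin (p 2) ^ 2 * v 3 ^ 2
            + (p 1 ^ 2 - 2 * M * p 1 + a ^ 2 * Real.cos (p 2) ^ 2)
              * (v 1 ^ 2 / kDelta M a p + v 2 ^ 2)) := by
  have hc : a ^ 2 * Real.cos (p 2) ^ 2 = kSigma a p - p 1 ^ 2 := by unfold kSigma; ring
  have hf : 1 - 2 * M * p 1 / kSigma a p = (kSigma a p - 2 * M * p 1) / kSigma a p := by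
    field_simp
  have hE' : kSigma a p - 2 * M * p 1 ≠ 0 := by
    intro h; apply hE; rw [hc]; linarith
  have hQ : p 1 ^ 2 - 2 * M * p 1 + a ^ 2 * Real.cos (p 2) ^ 2 = kSigma a p - 2 * M * p 1 := by
    rw [hc]; ring
  have hDs : kDelta M a p = kSigma a p - 2 * M * p 1 + a ^ 2 * Real.sin (p 2) ^ 2 := by
    rw [Real.sin_sq]; unfold kDelta kSigma; ring
  have hr : p 1 ^ 2 + a ^ 2 = kSigma a p + a ^ 2 * Real.sin (p 2) ^ 2 := by
    rw [Real.sin_sq]; unfold kSigma; ring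
  rw [hQ, hf]
  simp only [inner4, kerrMetric, Fin.sum_univ_four, Matrix.of_apply, Matrix.cons_val', hr, hf,
    Matrix.cons_val]
  rw [inv_div]
  generalize kSigma a p = S at *
  rw [hDs] at hD ⊢
  field_simp
  ring

/-- The Newman–Penrose tetrad of the Kerr metric. -/
def kerrTetrad (M a : ℝ) (p : Fin 4 → ℝ) : Tetrad where
  l := ![(p 1 ^ 2 + a ^ 2) / kDelta M a p, 1, 0, a / kDelta M a p]
  n := ![(p 1 ^ 2 + a ^ 2) / (2 * kSigma a p), -(kDelta M a p / (2 * kSigma a p)), 0,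
    a / (2 * kSigma a p)]
  m := (1 / ((Real.sqrt 2 : ℂ) * ((p 1 : ℂ) + Complex.I * a * Real.cos (p 2)))) •
    ![Complex.I * a * Real.sin (p 2), 0, 1, Complex.I / Real.sin (p 2)]

end

end KerrSVP

open KerrSVP

namespace KerrSVP

open Filter Topology Matrix

noncomputable section

/-! Everything is computed in the coframe (dt - a sin²θ dφ, dr, dθ, (r² + a²) dφ - a dt), in which
the Kerr metric is diagonal. The coframe is deliberately not normalized: no square root of Δ
appears, the sign of Δ plays no role, and all components stay rational in r, sin θ, cos θ, Σ, Δ. The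
connection matrices are written down explicitly. Metric compatibility and Cartan's first structure
equation characterize the Levi-Civita connection, so checking these two (`kerr_isMovingFrame`)
identifies the matrices with the Christoffel symbols (`christoffelMatrix_eq`), and the second
structure equation (`mul_riemannMatrix`) gives the curvature.

The outcome is that the Riemann tensor is a symmetric form on bivectors which couples each plane
only to itself (coefficient u) and to its complementary plane (coefficient v), where u + iv = M / (r
- ia cos θ)³. Its trace vanishes (`kerrForm_trace`), so the metric is Ricci flat and the Weyl and
Riemann tensors agree. The tetrad is adapted to the coframe: l, n span the first two frame
directions, m and its conjugate the last two, so all Weyl scalars except Ψ₂ = u + iv vanish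
(`kerr_psi`).

Under the ansatz write X = P + Q along these two planes; then Y = P - Q. Let α and β be the squared
norms of P and Q. The key identity (`kerr_curvature_reflect`) is R(Y, X)X = -2uβ P + 2uα Q. Since W
= -Y = -P + Q and X ≠ ±Y means P, Q ≠ 0, the problem becomes 2uβ = σ, 2uα = σ, α + β = 1. Here α =
-2x¹x², β = 2x³x⁴ and 2u = Ψ₂ + Ψ̄₂, which are the stated equations. Adding the first two gives σ =
u. As I = 3(u + iv)², also |I| + Re I = 6u². The choice α = β = 1/2 always gives a solution, and
replacing W by -W changes the sign of σ. -/

/-- `A'` is the entrywise partial derivative `∂_k A` at `p`. -/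
def HasMatrixPDeriv (k : Fin 4) (A : (Fin 4 → ℝ) → Matrix (Fin 4) (Fin 4) ℝ)
    (A' : Matrix (Fin 4) (Fin 4) ℝ) (p : Fin 4 → ℝ) : Prop :=
  ∀ i j, HasDerivAt (fun s => A (Function.update p k s) i j) (A' i j) (p k)

/-! ### Calculus of entrywise partial derivatives of matrix functions. -/

namespace HasMatrixPDeriv

variable {k : Fin 4} {A B : (Fin 4 → ℝ) → Matrix (Fin 4) (Fin 4) ℝ}
  {A' B' : Matrix (Fin 4) (Fin 4) ℝ} {p : Fin 4 → ℝ}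

theorem pderiv_eq (h : HasMatrixPDeriv k A A' p) (i j : Fin 4) :
    pderiv k (fun q => A q i j) p = A' i j :=
  (h i j).deriv

theorem unique (h : HasMatrixPDeriv k A A' p) (h' : HasMatrixPDeriv k A B' p) : A' = B' := by
  ext i j
  exact (h i j).unique (h' i j)

theorem add (hA : HasMatrixPDeriv k A A' p) (hB : HasMatrixPDeriv k B B' p) :
    HasMatrixPDeriv k (fun q => A q + B q) (A' + B') p :=
  fun i j => (hA i j).fun_add (hB i j)

theorem mul (hA : HasMatrixPDeriv k A A' p) (hB : HasMatrixPDeriv k B B' p) :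
    HasMatrixPDeriv k (fun q => A q * B q) (A' * B p + A p * B') p := by
  intro i j
  have h := HasDerivAt.fun_sum (u := Finset.univ) fun m _ => (hA i m).fun_mul (hB m j)
  simp only [Function.update_eq_self] at h
  simpa only [Matrix.mul_apply, Matrix.add_apply, Finset.sum_add_distrib] using h

theorem transpose (hA : HasMatrixPDeriv k A A' p) :
    HasMatrixPDeriv k (fun q => (A q)ᵀ) A'ᵀ p :=
  fun i j => hA j i

/-- Frame identities hold only on an open set, and a neighbourhood of `p` is enough to differentiate
them there. -/
theorem congr_of_eventuallyEq (hB : HasMatrixPDeriv k B B' p) (h : A =ᶠ[𝓝 p] B) :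
    HasMatrixPDeriv k A B' p := by
  intro i j
  refine (hB i j).congr_of_eventuallyEq ?_
  have hc : Tendsto (fun s => Function.update p k s) (𝓝 (p k)) (𝓝 p) := by
    have : Continuous fun s => Function.update p k s := continuous_const.update k continuous_id
    simpa using this.tendsto (p k)
  filter_upwards [hc.eventually h] with s hs
  rw [hs]

end HasMatrixPDeriv

/-! ### Moving frames: from the structure equations to Christoffel symbols and curvature. -/

/-- The matrix `(Γ^i_{kj})_{ij}` of the Levi-Civita connection along `∂_k`. -/
def christoffelMatrix (g : (Fin 4 → ℝ) → Matrix (Fin 4) (Fin 4) ℝ) (k : Fin 4)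
    (p : Fin 4 → ℝ) : Matrix (Fin 4) (Fin 4) ℝ :=
  Matrix.of fun i j => christoffel g i k j p

/-- The matrix `(R^i_{jkl})_{ij}`. -/
def riemannMatrix (g : (Fin 4 → ℝ) → Matrix (Fin 4) (Fin 4) ℝ) (p : Fin 4 → ℝ)
    (k l : Fin 4) : Matrix (Fin 4) (Fin 4) ℝ :=
  Matrix.of fun i j => riemannUp g p i j k l

theorem riemannMatrix_self (g : (Fin 4 → ℝ) → Matrix (Fin 4) (Fin 4) ℝ) (p : Fin 4 → ℝ)
    (k : Fin 4) : riemannMatrix g p k k = 0 := by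
  ext i j
  simp [riemannMatrix, riemannUp]

theorem riemannMatrix_eq {g : (Fin 4 → ℝ) → Matrix (Fin 4) (Fin 4) ℝ} {p : Fin 4 → ℝ}
    {k l : Fin 4} {A B : Matrix (Fin 4) (Fin 4) ℝ}
    (hA : HasMatrixPDeriv k (christoffelMatrix g l) A p)
    (hB : HasMatrixPDeriv l (christoffelMatrix g k) B p) :
    riemannMatrix g p k l = A - B + christoffelMatrix g k p * christoffelMatrix g l p
      - christoffelMatrix g l p * christoffelMatrix g k p := by
  ext i j
  have h1 := hA.pderiv_eq i j
  have h2 := hB.pderiv_eq i j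
  simp only [christoffelMatrix, Matrix.of_apply] at h1 h2
  simp only [riemannMatrix, riemannUp, christoffelMatrix, Matrix.of_apply, Matrix.sub_apply,
    Matrix.add_apply, Matrix.mul_apply, h1, h2, mul_comm (christoffel g _ _ j p)]

/-- A coframe `f` with dual frame `F` on an open set `U`, in which the metric has components `η`;
`ω k` is the connection matrix along `∂_k`, and `df k`, `dη k` are partial derivatives.  The last
two fields are metric compatibility and Cartan's first structure equation. -/
structure IsMovingFrame (U : Set (Fin 4 → ℝ)) (g f F η : (Fin 4 → ℝ) → Matrix (Fin 4) (Fin 4) ℝ)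
    (ω df dη : Fin 4 → (Fin 4 → ℝ) → Matrix (Fin 4) (Fin 4) ℝ) : Prop where
  isOpen : IsOpen U
  metric : ∀ q ∈ U, g q = (f q)ᵀ * η q * f q
  inv_mul : ∀ q ∈ U, F q * f q = 1
  det_ne : ∀ q ∈ U, (η q).det ≠ 0
  symm : ∀ q ∈ U, (η q)ᵀ = η q
  hasPDeriv_coframe : ∀ q ∈ U, ∀ k, HasMatrixPDeriv k f (df k q) q
  hasPDeriv_metric : ∀ q ∈ U, ∀ k, HasMatrixPDeriv k η (dη k q) q
  compat : ∀ q ∈ U, ∀ k, dη k q = η q * ω k q + (η q * ω k q)ᵀ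
  torsion : ∀ q ∈ U, ∀ k l A,
    (ω k q * f q + df k q) A l = (ω l q * f q + df l q) A k

namespace IsMovingFrame

variable {U : Set (Fin 4 → ℝ)} {g f F η : (Fin 4 → ℝ) → Matrix (Fin 4) (Fin 4) ℝ}
  {ω df dη : Fin 4 → (Fin 4 → ℝ) → Matrix (Fin 4) (Fin 4) ℝ} {q : Fin 4 → ℝ}

theorem mul_inv (h : IsMovingFrame U g f F η ω df dη) (hq : q ∈ U) : f q * F q = 1 :=
  mul_eq_one_comm.mp (h.inv_mul q hq)

theorem isUnit_det (h : IsMovingFrame U g f F η ω df dη) (hq : q ∈ U) : IsUnit (g q).det := by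
  have hf : (f q).det ≠ 0 := fun h0 => by
    have := congrArg Matrix.det (h.inv_mul q hq)
    simp [h0] at this
  rw [h.metric q hq, isUnit_iff_ne_zero]
  simp [hf, h.det_ne q hq]

/-- Product rule for fᵀηf, with compatibility used to replace dη. The derivative is B + Bᵀ for the
single matrix B = fᵀη(ωf + df), the form needed for the Koszul formula. -/
theorem hasPDeriv (h : IsMovingFrame U g f F η ω df dη) (hq : q ∈ U) (k : Fin 4) :
    HasMatrixPDeriv k g ((f q)ᵀ * η q * (ω k q * f q + df k q)
      + ((f q)ᵀ * η q * (ω k q * f q + df k q))ᵀ) q := by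
  have h1 := (((h.hasPDeriv_coframe q hq k).transpose.mul (h.hasPDeriv_metric q hq k)).mul
    (h.hasPDeriv_coframe q hq k)).congr_of_eventuallyEq
    (A := g) (by filter_upwards [h.isOpen.mem_nhds hq] with x hx using h.metric x hx)
  convert h1 using 1
  rw [h.compat q hq k]
  simp only [Matrix.transpose_mul, Matrix.transpose_add, Matrix.transpose_transpose, h.symm q hq]
  noncomm_ring

/-- With B as above, vanishing torsion says that B_k is symmetric under exchange of `k` with its
column index. In the Koszul combination of the three metric derivatives four of the six terms then
cancel, leaving 2B_k, so Γ_k = g⁻¹B_k. -/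
theorem christoffelMatrix_eq (h : IsMovingFrame U g f F η ω df dη) (hq : q ∈ U) (k : Fin 4) :
    christoffelMatrix g k q = F q * (ω k q * f q + df k q) := by
  set B : Fin 4 → Matrix (Fin 4) (Fin 4) ℝ :=
    fun k => (f q)ᵀ * η q * (ω k q * f q + df k q) with hB
  have hsymm : ∀ k l m, B k m l = B l m k := by
    intro k l m
    simp only [hB]
    rw [Matrix.mul_apply, Matrix.mul_apply]
    exact Finset.sum_congr rfl fun A _ => by rw [h.torsion q hq k l A]
  have hd : ∀ k i j, pderiv k (fun x => g x i j) q = B k i j + B k j i := fun k i j =>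
    (h.hasPDeriv hq k).pderiv_eq i j
  have h1 : christoffelMatrix g k q = (g q)⁻¹ * B k := by
    ext i j
    simp only [christoffelMatrix, Matrix.of_apply, christoffel, Matrix.mul_apply, hd,
      Finset.mul_sum]
    refine Finset.sum_congr rfl fun m _ => ?_
    rw [hsymm j k m, hsymm j m k, hsymm k m j]
    ring
  have h2 : B k = g q * (F q * (ω k q * f q + df k q)) := by
    rw [h.metric q hq, ← Matrix.mul_assoc, Matrix.mul_assoc _ (f q) (F q), h.mul_inv hq,
      Matrix.mul_one]
  rw [h1, h2, Matrix.nonsing_inv_mul_cancel_left _ _ (h.isUnit_det hq)]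

/-- Cartan's second structure equation. -/
theorem mul_riemannMatrix (h : IsMovingFrame U g f F η ω df dη) (hq : q ∈ U) {k l : Fin 4}
    {ωkl ωlk d2 Fk Fl : Matrix (Fin 4) (Fin 4) ℝ}
    (hkl : HasMatrixPDeriv k (ω l) ωkl q) (hlk : HasMatrixPDeriv l (ω k) ωlk q)
    (dkl : HasMatrixPDeriv k (df l) d2 q) (dlk : HasMatrixPDeriv l (df k) d2 q)
    (hFk : HasMatrixPDeriv k F Fk q) (hFl : HasMatrixPDeriv l F Fl q) :
    f q * riemannMatrix g q k l
      = (ωkl - ωlk + ω k q * ω l q - ω l q * ω k q) * f q := by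
  have hmem := h.isOpen.mem_nhds hq
  have hΓ : ∀ m, christoffelMatrix g m =ᶠ[𝓝 q] fun x => F x * (ω m x * f x + df m x) := fun m =>
    by filter_upwards [hmem] with x hx using h.christoffelMatrix_eq hx m
  have hfk := h.hasPDeriv_coframe q hq k
  have hfl := h.hasPDeriv_coframe q hq l
  have hA := (hFk.mul ((hkl.mul hfk).add dkl)).congr_of_eventuallyEq (hΓ l)
  have hB := (hFl.mul ((hlk.mul hfl).add dlk)).congr_of_eventuallyEq (hΓ k)
  have hone : ∀ m, HasMatrixPDeriv m (fun x => F x * f x) 0 q := by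
    intro m
    have h0 : HasMatrixPDeriv m (fun _ => (1 : Matrix (Fin 4) (Fin 4) ℝ)) 0 q := fun i j =>
      hasDerivAt_const _ _
    refine h0.congr_of_eventuallyEq ?_
    filter_upwards [hmem] with x hx using h.inv_mul x hx
  -- Differentiating F f = 1 expresses f·∂F through df, so the actual derivative of the dual frame
  -- is never needed, only its existence. The mixed second derivative `d2` of the coframe occurs in
  -- both terms and cancels.
  have e1 := (hFk.mul hfk).unique (hone k)
  have e2 := (hFl.mul hfl).unique (hone l)
  have i1 := h.mul_inv hq
  have g1 : f q * Fk = - (df k q * F q) := by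
    have : Fk * f q = -(F q * df k q) := eq_neg_of_add_eq_zero_left e1
    calc f q * Fk = f q * (Fk * f q) * F q := by
          rw [Matrix.mul_assoc, Matrix.mul_assoc, i1, Matrix.mul_one]
      _ = - ((f q * F q) * df k q * F q) := by rw [this]; noncomm_ring
      _ = _ := by rw [i1, Matrix.one_mul]
  have g2 : f q * Fl = - (df l q * F q) := by
    have : Fl * f q = -(F q * df l q) := eq_neg_of_add_eq_zero_left e2
    calc f q * Fl = f q * (Fl * f q) * F q := by
          rw [Matrix.mul_assoc, Matrix.mul_assoc, i1, Matrix.mul_one]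
      _ = - ((f q * F q) * df l q * F q) := by rw [this]; noncomm_ring
      _ = _ := by rw [i1, Matrix.one_mul]
  rw [riemannMatrix_eq hA hB, h.christoffelMatrix_eq hq, h.christoffelMatrix_eq hq]
  set P := ω k q * f q + df k q with hP
  set Q := ω l q * f q + df l q with hQ
  have hfF : ∀ X : Matrix (Fin 4) (Fin 4) ℝ, f q * (F q * X) = X := fun X => by
    rw [← Matrix.mul_assoc, i1, Matrix.one_mul]
  have hfk' : ∀ X : Matrix (Fin 4) (Fin 4) ℝ, f q * (Fk * X) = -(df k q * (F q * X)) := fun X => by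
    rw [← Matrix.mul_assoc, g1, Matrix.neg_mul, Matrix.mul_assoc]
  have hfl' : ∀ X : Matrix (Fin 4) (Fin 4) ℝ, f q * (Fl * X) = -(df l q * (F q * X)) := fun X => by
    rw [← Matrix.mul_assoc, g2, Matrix.neg_mul, Matrix.mul_assoc]
  -- Eliminating df in favour of P and Q makes the terms P F Q and Q F P cancel against the products
  -- of Christoffel matrices; what survives is the commutator of the ω's.
  have hdk : df k q = P - ω k q * f q := by rw [hP]; abel
  have hdl : df l q = Q - ω l q * f q := by rw [hQ]; abel
  simp only [Matrix.mul_sub, Matrix.mul_add, Matrix.mul_assoc, hfF, hfk', hfl']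
  rw [hdk, hdl]
  simp only [Matrix.sub_mul, Matrix.mul_sub, Matrix.add_mul, Matrix.mul_assoc, hfF]
  abel

end IsMovingFrame

/-! ### Explicit connection matrices for Kerr and their r and θ derivatives. -/

/-- Connection matrix along `∂_t`. -/
def connT (M a r s c S D : ℝ) : Matrix (Fin 4) (Fin 4) ℝ :=
  !![0, 2 * M * r ^ 2 / (S * D) - M / D, 0, 0;
     2 * M * r ^ 2 * D / S ^ 3 - M * D / S ^ 2, 0, 0, 0;
     0, 0, 0, 2 * M * a * r * s * c / S ^ 3;
     0, 0, -(2 * M * a * r * c / (s * S)), 0]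

/-- Connection matrix along `∂_r`. -/
def connR (M a r s c S D : ℝ) : Matrix (Fin 4) (Fin 4) ℝ :=
  !![-(M / D) + r / D - r / S, 0, 0, -(a * r * s ^ 2 / (S * D));
     0, M / D - r / D + r / S, -(a ^ 2 * s * c / S), 0;
     0, a ^ 2 * s * c / (S * D), r / S, 0;
     -(a * r / S), 0, 0, -(r / S)]

/-- Connection matrix along `∂_θ`. -/
def connH (a r s c S D : ℝ) : Matrix (Fin 4) (Fin 4) ℝ :=
  !![a ^ 2 * s * c / S, 0, 0, a * s * c / S;
     0, -(a ^ 2 * s * c / S), -(r * D / S), 0;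
     0, r / S, -(a ^ 2 * s * c / S), 0;
     a * c * D / (s * S), 0, 0, a ^ 2 * s * c / S + c / s]

/-- Connection matrix along `∂_φ`. -/
def connF (M a r s c S D : ℝ) : Matrix (Fin 4) (Fin 4) ℝ :=
  !![0, -(2 * M * a * r ^ 2 * s ^ 2 / (S * D)) + M * a * s ^ 2 / D - a * r * s ^ 2 / D,
       -(a * s * c), 0;
     -(2 * M * a * r ^ 2 * s ^ 2 * D / S ^ 3) + M * a * s ^ 2 * D / S ^ 2
       - a * r * s ^ 2 * D / S ^ 2, 0, 0, -(r * s ^ 2 * D / S ^ 2);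
     -(a * s * c * D / S ^ 2), 0, 0,
       -(2 * M * a ^ 2 * r * s ^ 3 * c / S ^ 3) - a ^ 2 * s * c / S ^ 2 - r ^ 2 * s * c / S ^ 2;
     0, r, 2 * M * a ^ 2 * r * s * c / S + a ^ 2 * c / s + r ^ 2 * c / s, 0]

/-- The `r` derivative of `connT`. -/
def connT_dr (M a r s c S D : ℝ) : Matrix (Fin 4) (Fin 4) ℝ :=
  !![0, 4 * M ^ 2 * r ^ 2 / (S * D ^ 2) - 2 * M ^ 2 / D ^ 2 - 4 * M * r ^ 3 / (S * D ^ 2)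
       - 4 * M * r ^ 3 / (S ^ 2 * D) + 2 * M * r / D ^ 2 + 4 * M * r / (S * D), 0, 0;
     -(4 * M ^ 2 * r ^ 2 / S ^ 3) + 2 * M ^ 2 / S ^ 2 + 4 * M * r ^ 3 / S ^ 3
       - 12 * M * r ^ 3 * D / S ^ 4 - 2 * M * r / S ^ 2 + 8 * M * r * D / S ^ 3, 0, 0, 0;
     0, 0, 0, -(12 * M * a * r ^ 2 * s * c / S ^ 4) + 2 * M * a * s * c / S ^ 3;
     0, 0, 4 * M * a * r ^ 2 * c / (s * S ^ 2) - 2 * M * a * c / (s * S), 0]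

/-- The `r` derivative of `connH`. -/
def connH_dr (M a r s c S D : ℝ) : Matrix (Fin 4) (Fin 4) ℝ :=
  !![-(2 * a ^ 2 * r * s * c / S ^ 2), 0, 0, -(2 * a * r * s * c / S ^ 2);
     0, 2 * a ^ 2 * r * s * c / S ^ 2,
       2 * M * r / S - 2 * r ^ 2 / S + 2 * r ^ 2 * D / S ^ 2 - D / S, 0;
     0, -(2 * r ^ 2 / S ^ 2) + 1 / S, 2 * a ^ 2 * r * s * c / S ^ 2, 0;
     -(2 * M * a * c / (s * S)) + 2 * a * r * c / (s * S) - 2 * a * r * c * D / (s * S ^ 2), 0,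
       0, -(2 * a ^ 2 * r * s * c / S ^ 2)]

/-- The `r` derivative of `connF`. -/
def connF_dr (M a r s c S D : ℝ) : Matrix (Fin 4) (Fin 4) ℝ :=
  !![0, -(4 * M ^ 2 * a * r ^ 2 * s ^ 2 / (S * D ^ 2)) + 2 * M ^ 2 * a * s ^ 2 / D ^ 2
       + 4 * M * a * r ^ 3 * s ^ 2 / (S * D ^ 2) + 4 * M * a * r ^ 3 * s ^ 2 / (S ^ 2 * D)
       - 4 * M * a * r * s ^ 2 / D ^ 2 - 4 * M * a * r * s ^ 2 / (S * D)
       + 2 * a * r ^ 2 * s ^ 2 / D ^ 2 - a * s ^ 2 / D, 0, 0;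
     4 * M ^ 2 * a * r ^ 2 * s ^ 2 / S ^ 3 - 2 * M ^ 2 * a * s ^ 2 / S ^ 2
       - 4 * M * a * r ^ 3 * s ^ 2 / S ^ 3 + 12 * M * a * r ^ 3 * s ^ 2 * D / S ^ 4
       + 4 * M * a * r * s ^ 2 / S ^ 2 - 8 * M * a * r * s ^ 2 * D / S ^ 3
       - 2 * a * r ^ 2 * s ^ 2 / S ^ 2 + 4 * a * r ^ 2 * s ^ 2 * D / S ^ 3
       - a * s ^ 2 * D / S ^ 2, 0, 0,
       2 * M * r * s ^ 2 / S ^ 2 - 2 * r ^ 2 * s ^ 2 / S ^ 2 + 4 * r ^ 2 * s ^ 2 * D / S ^ 3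
       - s ^ 2 * D / S ^ 2;
     2 * M * a * s * c / S ^ 2 - 2 * a * r * s * c / S ^ 2 + 4 * a * r * s * c * D / S ^ 3, 0,
       0, 12 * M * a ^ 2 * r ^ 2 * s ^ 3 * c / S ^ 4 - 2 * M * a ^ 2 * s ^ 3 * c / S ^ 3
       + 4 * a ^ 2 * r * s * c / S ^ 3 + 4 * r ^ 3 * s * c / S ^ 3 - 2 * r * s * c / S ^ 2;
     0, 1, -(4 * M * a ^ 2 * r ^ 2 * s * c / S ^ 2) + 2 * M * a ^ 2 * s * c / S + 2 * r * c / s, 0]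

/-- The `θ` derivative of `connT`. -/
def connT_dh (M a r s c S D : ℝ) : Matrix (Fin 4) (Fin 4) ℝ :=
  !![0, 4 * M * a ^ 2 * r ^ 2 * s * c / (S ^ 2 * D), 0, 0;
     12 * M * a ^ 2 * r ^ 2 * s * c * D / S ^ 4 - 4 * M * a ^ 2 * s * c * D / S ^ 3, 0, 0, 0;
     0, 0, 0,
       12 * M * a ^ 3 * r * s ^ 2 * c ^ 2 / S ^ 4 - 2 * M * a * r * s ^ 2 / S ^ 3
       + 2 * M * a * r * c ^ 2 / S ^ 3;
     0, 0, -(4 * M * a ^ 3 * r * c ^ 2 / S ^ 2) + 2 * M * a * r / S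
       + 2 * M * a * r * c ^ 2 / (s ^ 2 * S), 0]

/-- The `θ` derivative of `connR`. -/
def connR_dh (a r s c S D : ℝ) : Matrix (Fin 4) (Fin 4) ℝ :=
  !![-(2 * a ^ 2 * r * s * c / S ^ 2), 0, 0,
       -(2 * a ^ 3 * r * s ^ 3 * c / (S ^ 2 * D)) - 2 * a * r * s * c / (S * D);
     0, 2 * a ^ 2 * r * s * c / S ^ 2,
       -(2 * a ^ 4 * s ^ 2 * c ^ 2 / S ^ 2) + a ^ 2 * s ^ 2 / S - a ^ 2 * c ^ 2 / S, 0;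
     0, 2 * a ^ 4 * s ^ 2 * c ^ 2 / (S ^ 2 * D) - a ^ 2 * s ^ 2 / (S * D)
       + a ^ 2 * c ^ 2 / (S * D), 2 * a ^ 2 * r * s * c / S ^ 2, 0;
     -(2 * a ^ 3 * r * s * c / S ^ 2), 0, 0, -(2 * a ^ 2 * r * s * c / S ^ 2)]

/-- The `θ` derivative of `connF`. -/
def connF_dh (M a r s c S D : ℝ) : Matrix (Fin 4) (Fin 4) ℝ :=
  !![0, -(4 * M * a ^ 3 * r ^ 2 * s ^ 3 * c / (S ^ 2 * D))
       - 4 * M * a * r ^ 2 * s * c / (S * D) + 2 * M * a * s * c / D - 2 * a * r * s * c / D,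
       a * s ^ 2 - a * c ^ 2, 0;
     -(12 * M * a ^ 3 * r ^ 2 * s ^ 3 * c * D / S ^ 4) + 4 * M * a ^ 3 * s ^ 3 * c * D / S ^ 3
       - 4 * M * a * r ^ 2 * s * c * D / S ^ 3 + 2 * M * a * s * c * D / S ^ 2
       - 4 * a ^ 3 * r * s ^ 3 * c * D / S ^ 3 - 2 * a * r * s * c * D / S ^ 2, 0, 0,
       -(4 * a ^ 2 * r * s ^ 3 * c * D / S ^ 3) - 2 * r * s * c * D / S ^ 2;
     -(4 * a ^ 3 * s ^ 2 * c ^ 2 * D / S ^ 3) + a * s ^ 2 * D / S ^ 2 - a * c ^ 2 * D / S ^ 2,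
       0, 0,
       -(12 * M * a ^ 4 * r * s ^ 4 * c ^ 2 / S ^ 4) + 2 * M * a ^ 2 * r * s ^ 4 / S ^ 3
       - 6 * M * a ^ 2 * r * s ^ 2 * c ^ 2 / S ^ 3 - 4 * a ^ 4 * s ^ 2 * c ^ 2 / S ^ 3
       - 4 * a ^ 2 * r ^ 2 * s ^ 2 * c ^ 2 / S ^ 3 + a ^ 2 * s ^ 2 / S ^ 2
       - a ^ 2 * c ^ 2 / S ^ 2 + r ^ 2 * s ^ 2 / S ^ 2 - r ^ 2 * c ^ 2 / S ^ 2;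
     0, 0, 4 * M * a ^ 4 * r * s ^ 2 * c ^ 2 / S ^ 2 - 2 * M * a ^ 2 * r * s ^ 2 / S
       + 2 * M * a ^ 2 * r * c ^ 2 / S - a ^ 2 - a ^ 2 * c ^ 2 / s ^ 2 - r ^ 2
       - r ^ 2 * c ^ 2 / s ^ 2, 0]

/-! ### Verification of these derivatives. -/

section

variable {M a r s c h : ℝ} {S : ℝ → ℝ}

section

variable {D : ℝ → ℝ}

/-- Σ and Δ stay abstract functions of which only the value, the derivative and non-vanishing are
known. This keeps each entry a short quotient of monomials, and the comparison of derivatives is an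
identity in independent letters. -/
theorem connT_hasDerivAt_r (hS : HasDerivAt S (2 * r) r) (hD : HasDerivAt D (2 * r - 2 * M) r)
    (hS0 : S r ≠ 0) (hD0 : D r ≠ 0) (hs0 : s ≠ 0) (i j : Fin 4) :
    HasDerivAt (fun x => connT M a x s c (S x) (D x) i j)
      (connT_dr M a r s c (S r) (D r) i j) r := by
  fin_cases i <;> fin_cases j <;> simp [connT, connT_dr, hasDerivAt_const]
  all_goals
    -- The derivative is assembled along the syntax of the entry, with `positivity` discharging the
    -- non-vanishing of denominators; its value is then matched by clearing denominators.
    apply HasDerivAt.congr_deriv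
    · repeat' first
        | exact hasDerivAt_const _ _
        | exact hasDerivAt_id' _
        | exact hS
        | exact hD
        | with_reducible apply HasDerivAt.fun_add
        | with_reducible apply HasDerivAt.fun_sub
        | with_reducible apply HasDerivAt.fun_neg
        | with_reducible apply HasDerivAt.fun_mul
        | with_reducible apply HasDerivAt.fun_div
        | with_reducible apply HasDerivAt.fun_pow
        | positivity
    · field_simp
      ring

theorem connH_hasDerivAt_r (hS : HasDerivAt S (2 * r) r) (hD : HasDerivAt D (2 * r - 2 * M) r)
    (hS0 : S r ≠ 0) (hs0 : s ≠ 0) (i j : Fin 4) :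
    HasDerivAt (fun x => connH a x s c (S x) (D x) i j)
      (connH_dr M a r s c (S r) (D r) i j) r := by
  fin_cases i <;> fin_cases j <;> simp [connH, connH_dr, hasDerivAt_const]
  all_goals
    apply HasDerivAt.congr_deriv
    · repeat' first
        | exact hasDerivAt_const _ _
        | exact hasDerivAt_id' _
        | exact hS
        | exact hD
        | with_reducible apply HasDerivAt.fun_add
        | with_reducible apply HasDerivAt.fun_sub
        | with_reducible apply HasDerivAt.fun_neg
        | with_reducible apply HasDerivAt.fun_mul
        | with_reducible apply HasDerivAt.fun_div
        | with_reducible apply HasDerivAt.fun_pow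
        | positivity
    · field_simp
      ring

theorem connF_hasDerivAt_r (hS : HasDerivAt S (2 * r) r) (hD : HasDerivAt D (2 * r - 2 * M) r)
    (hS0 : S r ≠ 0) (hD0 : D r ≠ 0) (hs0 : s ≠ 0) (i j : Fin 4) :
    HasDerivAt (fun x => connF M a x s c (S x) (D x) i j)
      (connF_dr M a r s c (S r) (D r) i j) r := by
  fin_cases i <;> fin_cases j <;> simp [connF, connF_dr, hasDerivAt_const]
  all_goals
    apply HasDerivAt.congr_deriv
    · repeat' first
        | exact hasDerivAt_const _ _
        | exact hasDerivAt_id' _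
        | exact hS
        | exact hD
        | with_reducible apply HasDerivAt.fun_add
        | with_reducible apply HasDerivAt.fun_sub
        | with_reducible apply HasDerivAt.fun_neg
        | with_reducible apply HasDerivAt.fun_mul
        | with_reducible apply HasDerivAt.fun_div
        | with_reducible apply HasDerivAt.fun_pow
        | positivity
    · field_simp
      try ring

end

section

variable {D : ℝ}

theorem connT_hasDerivAt_h (hS : HasDerivAt S (-(2 * a ^ 2 * Real.sin h * Real.cos h)) h)
    (hS0 : S h ≠ 0) (hD0 : D ≠ 0) (hs0 : Real.sin h ≠ 0) (i j : Fin 4) :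
    HasDerivAt (fun x => connT M a r (Real.sin x) (Real.cos x) (S x) D i j)
      (connT_dh M a r (Real.sin h) (Real.cos h) (S h) D i j) h := by
  fin_cases i <;> fin_cases j <;> simp [connT, connT_dh, hasDerivAt_const]
  all_goals
    apply HasDerivAt.congr_deriv
    · repeat' first
        | exact hasDerivAt_const _ _
        | exact Real.hasDerivAt_sin _
        | exact Real.hasDerivAt_cos _
        | exact hS
        | with_reducible apply HasDerivAt.fun_add
        | with_reducible apply HasDerivAt.fun_sub
        | with_reducible apply HasDerivAt.fun_neg
        | with_reducible apply HasDerivAt.fun_mul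
        | with_reducible apply HasDerivAt.fun_div
        | with_reducible apply HasDerivAt.fun_pow
        | positivity
    · field_simp
      ring

theorem connR_hasDerivAt_h (hS : HasDerivAt S (-(2 * a ^ 2 * Real.sin h * Real.cos h)) h)
    (hS0 : S h ≠ 0) (hD0 : D ≠ 0) (i j : Fin 4) :
    HasDerivAt (fun x => connR M a r (Real.sin x) (Real.cos x) (S x) D i j)
      (connR_dh a r (Real.sin h) (Real.cos h) (S h) D i j) h := by
  fin_cases i <;> fin_cases j <;> simp [connR, connR_dh, hasDerivAt_const]
  all_goals
    apply HasDerivAt.congr_deriv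
    · repeat' first
        | exact hasDerivAt_const _ _
        | exact Real.hasDerivAt_sin _
        | exact Real.hasDerivAt_cos _
        | exact hS
        | with_reducible apply HasDerivAt.fun_add
        | with_reducible apply HasDerivAt.fun_sub
        | with_reducible apply HasDerivAt.fun_neg
        | with_reducible apply HasDerivAt.fun_mul
        | with_reducible apply HasDerivAt.fun_div
        | with_reducible apply HasDerivAt.fun_pow
        | positivity
    · field_simp
      ring

theorem connF_hasDerivAt_h (hS : HasDerivAt S (-(2 * a ^ 2 * Real.sin h * Real.cos h)) h)
    (hS0 : S h ≠ 0) (hD0 : D ≠ 0) (hs0 : Real.sin h ≠ 0) (i j : Fin 4) :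
    HasDerivAt (fun x => connF M a r (Real.sin x) (Real.cos x) (S x) D i j)
      (connF_dh M a r (Real.sin h) (Real.cos h) (S h) D i j) h := by
  fin_cases i <;> fin_cases j <;> simp [connF, connF_dh, hasDerivAt_const]
  all_goals
    apply HasDerivAt.congr_deriv
    · repeat' first
        | exact hasDerivAt_const _ _
        | exact Real.hasDerivAt_sin _
        | exact Real.hasDerivAt_cos _
        | exact hS
        | with_reducible apply HasDerivAt.fun_add
        | with_reducible apply HasDerivAt.fun_sub
        | with_reducible apply HasDerivAt.fun_neg
        | with_reducible apply HasDerivAt.fun_mul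
        | with_reducible apply HasDerivAt.fun_div
        | with_reducible apply HasDerivAt.fun_pow
        | positivity
    · field_simp
      ring

end

end

/-! ### The Kerr metric as a moving frame. -/

/-- The coframe `(dt - a sin² θ dφ, dr, dθ, (r² + a²) dφ - a dt)` of the Kerr metric. -/
def kerrCoframe (a : ℝ) (q : Fin 4 → ℝ) : Matrix (Fin 4) (Fin 4) ℝ :=
  !![1, 0, 0, -(a * Real.sin (q 2) ^ 2); 0, 1, 0, 0; 0, 0, 1, 0; -a, 0, 0, q 1 ^ 2 + a ^ 2]

/-- The frame dual to `kerrCoframe`. -/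
def kerrFrame (a : ℝ) (q : Fin 4 → ℝ) : Matrix (Fin 4) (Fin 4) ℝ :=
  !![(q 1 ^ 2 + a ^ 2) / kSigma a q, 0, 0, a * Real.sin (q 2) ^ 2 / kSigma a q;
     0, 1, 0, 0;
     0, 0, 1, 0;
     a / kSigma a q, 0, 0, 1 / kSigma a q]

/-- The components of the Kerr metric in the coframe `kerrCoframe`. -/
def kerrEta (M a : ℝ) (q : Fin 4 → ℝ) : Matrix (Fin 4) (Fin 4) ℝ :=
  !![-(kDelta M a q / kSigma a q), 0, 0, 0;
     0, kSigma a q / kDelta M a q, 0, 0;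
     0, 0, kSigma a q, 0;
     0, 0, 0, Real.sin (q 2) ^ 2 / kSigma a q]

/-- The connection matrices of the Kerr metric in the coframe `kerrCoframe`. -/
def kerrConnection (M a : ℝ) (k : Fin 4) (q : Fin 4 → ℝ) : Matrix (Fin 4) (Fin 4) ℝ :=
  ![connT M a (q 1) (Real.sin (q 2)) (Real.cos (q 2)) (kSigma a q) (kDelta M a q),
    connR M a (q 1) (Real.sin (q 2)) (Real.cos (q 2)) (kSigma a q) (kDelta M a q),
    connH a (q 1) (Real.sin (q 2)) (Real.cos (q 2)) (kSigma a q) (kDelta M a q),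
    connF M a (q 1) (Real.sin (q 2)) (Real.cos (q 2)) (kSigma a q) (kDelta M a q)] k

/-- The domain of the Boyer–Lindquist coordinates. -/
def kerrDomain (M a : ℝ) : Set (Fin 4 → ℝ) :=
  {q | kSigma a q ≠ 0 ∧ kDelta M a q ≠ 0 ∧ Real.sin (q 2) ≠ 0}

/-- Partial derivatives of `kerrCoframe`. -/
def kerrCoframe_d (a : ℝ) (k : Fin 4) (q : Fin 4 → ℝ) : Matrix (Fin 4) (Fin 4) ℝ :=
  ![0, !![0, 0, 0, 0; 0, 0, 0, 0; 0, 0, 0, 0; 0, 0, 0, 2 * q 1],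
    !![0, 0, 0, -(2 * a * Real.sin (q 2) * Real.cos (q 2)); 0, 0, 0, 0; 0, 0, 0, 0; 0, 0, 0, 0],
    0] k

/-- Partial derivatives of `kerrEta`. -/
def kerrEta_d (M a : ℝ) (k : Fin 4) (q : Fin 4 → ℝ) : Matrix (Fin 4) (Fin 4) ℝ :=
  ![0, Matrix.diagonal
      ![(2 * q 1 * kDelta M a q - (2 * q 1 - 2 * M) * kSigma a q) / kSigma a q ^ 2,
        ((2 * q 1) * kDelta M a q - (2 * q 1 - 2 * M) * kSigma a q) / kDelta M a q ^ 2,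
        2 * q 1, -(2 * q 1 * Real.sin (q 2) ^ 2 / kSigma a q ^ 2)],
    Matrix.diagonal ((2 * Real.sin (q 2) * Real.cos (q 2)) •
      ![-(a ^ 2 * kDelta M a q / kSigma a q ^ 2), -(a ^ 2 / kDelta M a q), -(a ^ 2),
        (kSigma a q + a ^ 2 * Real.sin (q 2) ^ 2) / kSigma a q ^ 2]),
    0] k

section

variable (M a : ℝ) (q : Fin 4 → ℝ)

theorem kerrConnection_0 : kerrConnection M a 0 q =
    connT M a (q 1) (Real.sin (q 2)) (Real.cos (q 2)) (kSigma a q) (kDelta M a q) := rfl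

theorem kerrConnection_1 : kerrConnection M a 1 q =
    connR M a (q 1) (Real.sin (q 2)) (Real.cos (q 2)) (kSigma a q) (kDelta M a q) := rfl

theorem kerrConnection_2 : kerrConnection M a 2 q =
    connH a (q 1) (Real.sin (q 2)) (Real.cos (q 2)) (kSigma a q) (kDelta M a q) := rfl

theorem kerrConnection_3 : kerrConnection M a 3 q =
    connF M a (q 1) (Real.sin (q 2)) (Real.cos (q 2)) (kSigma a q) (kDelta M a q) := rfl

theorem kerrCoframe_d_0 : kerrCoframe_d a 0 q =
    0 := rfl

theorem kerrCoframe_d_1 : kerrCoframe_d a 1 q =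
    !![0, 0, 0, 0; 0, 0, 0, 0; 0, 0, 0, 0; 0, 0, 0, 2 * q 1] := rfl

theorem kerrCoframe_d_2 : kerrCoframe_d a 2 q =
    !![0, 0, 0, -(2 * a * Real.sin (q 2) * Real.cos (q 2)); 0, 0, 0, 0; 0, 0, 0, 0; 0, 0, 0, 0] := rfl

theorem kerrCoframe_d_3 : kerrCoframe_d a 3 q =
    0 := rfl

theorem kerrEta_d_0 : kerrEta_d M a 0 q =
    0 := rfl

theorem kerrEta_d_1 : kerrEta_d M a 1 q =
    Matrix.diagonal
      ![(2 * q 1 * kDelta M a q - (2 * q 1 - 2 * M) * kSigma a q) / kSigma a q ^ 2,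
        ((2 * q 1) * kDelta M a q - (2 * q 1 - 2 * M) * kSigma a q) / kDelta M a q ^ 2,
        2 * q 1, -(2 * q 1 * Real.sin (q 2) ^ 2 / kSigma a q ^ 2)] := rfl

theorem kerrEta_d_2 : kerrEta_d M a 2 q =
    Matrix.diagonal ((2 * Real.sin (q 2) * Real.cos (q 2)) •
      ![-(a ^ 2 * kDelta M a q / kSigma a q ^ 2), -(a ^ 2 / kDelta M a q), -(a ^ 2),
        (kSigma a q + a ^ 2 * Real.sin (q 2) ^ 2) / kSigma a q ^ 2]) := rfl

theorem kerrEta_d_3 : kerrEta_d M a 3 q =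
    0 := rfl

end

theorem hasDerivAt_kSigma_r (a : ℝ) (q : Fin 4 → ℝ) :
    HasDerivAt (fun s => kSigma a (Function.update q 1 s)) (2 * q 1) (q 1) := by
  have := ((hasDerivAt_id' (q 1)).fun_pow 2).add_const (a ^ 2 * Real.cos (q 2) ^ 2)
  simpa [kSigma] using this

theorem hasDerivAt_kSigma_h (a : ℝ) (q : Fin 4 → ℝ) :
    HasDerivAt (fun s => kSigma a (Function.update q 2 s))
      (-(2 * a ^ 2 * Real.sin (q 2) * Real.cos (q 2))) (q 2) := by
  have := (((Real.hasDerivAt_cos (q 2)).fun_pow 2).const_mul (a ^ 2)).const_add (q 1 ^ 2)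
  have h : (fun s => kSigma a (Function.update q 2 s))
      = fun s => q 1 ^ 2 + a ^ 2 * Real.cos s ^ 2 := by
    ext s
    simp [kSigma]
  rw [h]
  refine this.congr_deriv ?_
  simp
  ring

theorem hasDerivAt_kDelta_r (M a : ℝ) (q : Fin 4 → ℝ) :
    HasDerivAt (fun s => kDelta M a (Function.update q 1 s)) (2 * q 1 - 2 * M) (q 1) := by
  have := (((hasDerivAt_id' (q 1)).fun_pow 2).fun_sub
    ((hasDerivAt_id' (q 1)).const_mul (2 * M))).add_const (a ^ 2)
  simpa [kDelta] using this

@[simp] theorem kDelta_update_h (M a : ℝ) (q : Fin 4 → ℝ) (x : ℝ) :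
    kDelta M a (Function.update q 2 x) = kDelta M a q := by
  simp [kDelta]

@[simp] theorem kSigma_update_t (a : ℝ) (q : Fin 4 → ℝ) (x : ℝ) :
    kSigma a (Function.update q 0 x) = kSigma a q := by
  simp [kSigma]

@[simp] theorem kSigma_update_f (a : ℝ) (q : Fin 4 → ℝ) (x : ℝ) :
    kSigma a (Function.update q 3 x) = kSigma a q := by
  simp [kSigma]

@[simp] theorem kDelta_update_t (M a : ℝ) (q : Fin 4 → ℝ) (x : ℝ) :
    kDelta M a (Function.update q 0 x) = kDelta M a q := by
  simp [kDelta]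

@[simp] theorem kDelta_update_f (M a : ℝ) (q : Fin 4 → ℝ) (x : ℝ) :
    kDelta M a (Function.update q 3 x) = kDelta M a q := by
  simp [kDelta]

/-- Covers the t and φ derivatives, since the metric is stationary and axisymmetric, and the mixed
second derivatives of the coframe. -/
theorem hasMatrixPDeriv_const_of {k : Fin 4} {A : (Fin 4 → ℝ) → Matrix (Fin 4) (Fin 4) ℝ}
    {p : Fin 4 → ℝ} (h : ∀ s, A (Function.update p k s) = A p) : HasMatrixPDeriv k A 0 p := by
  intro i j
  simp only [h]
  exact hasDerivAt_const _ _

theorem kerrCoframe_hasPDeriv (a : ℝ) (q : Fin 4 → ℝ) (k : Fin 4) :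
    HasMatrixPDeriv k (kerrCoframe a) (kerrCoframe_d a k q) q := by
  fin_cases k
  · exact hasMatrixPDeriv_const_of fun s => by simp [kerrCoframe]
  · intro i j
    have := ((hasDerivAt_id' (q 1)).fun_pow 2).add_const (a ^ 2)
    fin_cases i <;> fin_cases j <;> simp [kerrCoframe, kerrCoframe_d_1, hasDerivAt_const]
    simpa using this
  · intro i j
    have := (((Real.hasDerivAt_sin (q 2)).fun_pow 2).const_mul a).fun_neg
    fin_cases i <;> fin_cases j <;> simp [kerrCoframe, kerrCoframe_d_2, hasDerivAt_const]
    refine this.congr_deriv ?_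
    simp
    ring
  · exact hasMatrixPDeriv_const_of fun s => by simp [kerrCoframe]

/-- Existence is enough: the derivative of the dual frame drops out of Cartan's second equation. -/
theorem kerrFrame_hasPDeriv {a : ℝ} {q : Fin 4 → ℝ} (hS : kSigma a q ≠ 0) (k : Fin 4) :
    ∃ A, HasMatrixPDeriv k (kerrFrame a) A q := by
  suffices h : ∀ i j, DifferentiableAt ℝ (fun s => kerrFrame a (Function.update q k s) i j) (q k)
    from ⟨Matrix.of fun i j => deriv (fun s => kerrFrame a (Function.update q k s) i j) (q k),
      fun i j => (h i j).hasDerivAt⟩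
  intro i j
  have hS' : kSigma a (Function.update q k (q k)) ≠ 0 := by rwa [Function.update_eq_self]
  have h1 : ∀ m, DifferentiableAt ℝ (fun s => Function.update q k s m) (q k) := fun m => by
    rcases eq_or_ne m k with rfl | hm
    · simp
    · simp [Function.update_of_ne hm]
  have hd : DifferentiableAt ℝ (fun s => kSigma a (Function.update q k s)) (q k) := by
    have h1' := h1 1
    have h2' := h1 2
    unfold kSigma
    fun_prop
  have h1' := h1 1
  have h2' := h1 2
  fin_cases i <;> fin_cases j <;> simp [kerrFrame] <;>
    fun_prop (disch := assumption)

theorem kerrEta_hasPDeriv {M a : ℝ} {q : Fin 4 → ℝ} (hq : q ∈ kerrDomain M a) (k : Fin 4) :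
    HasMatrixPDeriv k (kerrEta M a) (kerrEta_d M a k q) q := by
  obtain ⟨hS, hD, hs⟩ := hq
  have hS1 := hasDerivAt_kSigma_r a q
  have hS2 := hasDerivAt_kSigma_h a q
  have hD1 := hasDerivAt_kDelta_r M a q
  have eS1 : kSigma a (Function.update q 1 (q 1)) = kSigma a q := by simp
  have eS2 : kSigma a (Function.update q 2 (q 2)) = kSigma a q := by simp
  have eD1 : kDelta M a (Function.update q 1 (q 1)) = kDelta M a q := by simp
  fin_cases k
  · exact hasMatrixPDeriv_const_of fun s => by simp [kerrEta]
  · intro i j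
    fin_cases i <;> fin_cases j <;> simp [kerrEta, kerrEta_d_1, hasDerivAt_const]
    · refine ((hD1.fun_div hS1 (by simpa)).fun_neg).congr_deriv ?_
      rw [eS1, eD1]; field_simp; ring
    · refine (hS1.fun_div hD1 (by simpa)).congr_deriv ?_
      rw [eS1, eD1]; field_simp
    · exact hS1
    · refine ((hasDerivAt_const _ _).fun_div hS1 (by simpa)).congr_deriv ?_
      rw [eS1]; field_simp; ring
  · intro i j
    fin_cases i <;> fin_cases j <;> simp [kerrEta, kerrEta_d_2, hasDerivAt_const]
    · refine (((hasDerivAt_const _ _).fun_div hS2 (by simpa)).fun_neg).congr_deriv ?_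
      rw [eS2]; field_simp; ring
    · refine (hS2.div_const _).congr_deriv ?_
      field_simp
    · exact hS2.congr_deriv (by ring)
    · refine (((Real.hasDerivAt_sin (q 2)).fun_pow 2).fun_div hS2 (by simpa)).congr_deriv ?_
      rw [eS2]; field_simp; simp; ring
  · exact hasMatrixPDeriv_const_of fun s => by simp [kerrEta]

theorem kerrDomain_isOpen (M a : ℝ) : IsOpen (kerrDomain M a) := by
  refine IsOpen.and ?_ (IsOpen.and ?_ ?_)
  all_goals
    refine isOpen_ne_fun ?_ continuous_const
    first | (unfold kSigma; fun_prop) | (unfold kDelta; fun_prop) | fun_prop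

section

variable {M a : ℝ} {q : Fin 4 → ℝ}

/-- Carter's form of the line element: -(Δ/Σ)(dt - a sin²θ dφ)² + (Σ/Δ) dr² + Σ dθ² + (sin²θ/Σ)((r²
+ a²) dφ - a dt)². -/
theorem kerrMetric_eq (hq : q ∈ kerrDomain M a) :
    kerrMetric M a q = (kerrCoframe a q)ᵀ * kerrEta M a q * kerrCoframe a q := by
  obtain ⟨hS, hD, hs⟩ := hq
  have hc : Real.sin (q 2) ^ 2 = 1 - Real.cos (q 2) ^ 2 := Real.sin_sq _
  ext i j
  fin_cases i <;> fin_cases j <;>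
    simp [kerrMetric, kerrCoframe, kerrEta, Matrix.mul_apply, Fin.sum_univ_four] <;>
    field_simp <;> simp only [kSigma, kDelta, hc] <;> ring

/-- The only nontrivial block is the one of dt and dφ, whose determinant is r² + a² - a² sin²θ = Σ.
-/
theorem kerrFrame_mul_kerrCoframe (hS : kSigma a q ≠ 0) :
    kerrFrame a q * kerrCoframe a q = 1 := by
  have hc : Real.sin (q 2) ^ 2 = 1 - Real.cos (q 2) ^ 2 := Real.sin_sq _
  ext i j
  fin_cases i <;> fin_cases j <;>
    simp [kerrCoframe, kerrFrame] <;>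
    field_simp <;> simp only [kSigma, hc] <;> ring

theorem kerrEta_eq_diagonal (M a : ℝ) (q : Fin 4 → ℝ) :
    kerrEta M a q = Matrix.diagonal ![-(kDelta M a q / kSigma a q),
      kSigma a q / kDelta M a q, kSigma a q, Real.sin (q 2) ^ 2 / kSigma a q] := by
  ext i j
  fin_cases i <;> fin_cases j <;> simp [kerrEta]

theorem kerrEta_det_ne (hq : q ∈ kerrDomain M a) : (kerrEta M a q).det ≠ 0 := by
  obtain ⟨hS, hD, hs⟩ := hq
  rw [kerrEta_eq_diagonal, Matrix.det_diagonal]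
  simp [Fin.prod_univ_four, hS, hD, hs]

-- As η is diagonal, the condition says that the diagonal of ω_k is half the logarithmic derivative
-- of η, and that after lowering an index the off-diagonal part is antisymmetric.
set_option maxHeartbeats 1000000 in
theorem kerrConnection_compat (hq : q ∈ kerrDomain M a) (k : Fin 4) :
    kerrEta_d M a k q
      = kerrEta M a q * kerrConnection M a k q + (kerrEta M a q * kerrConnection M a k q)ᵀ := by
  obtain ⟨hS, hD, hs⟩ := hq
  fin_cases k <;>
    simp only [Fin.zero_eta, Fin.mk_one, Fin.reduceFinMk, kerrConnection_0, kerrConnection_1,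
      kerrConnection_2, kerrConnection_3, kerrEta_d_0, kerrEta_d_1, kerrEta_d_2, kerrEta_d_3] <;>
    ext i j <;> fin_cases i <;> fin_cases j <;>
    simp [kerrEta, connT, connR, connH, connF, Matrix.diagonal] <;>
    field_simp <;> try ring

theorem kerrConnection_torsion (hq : q ∈ kerrDomain M a) (k l A : Fin 4) :
    (kerrConnection M a k q * kerrCoframe a q + kerrCoframe_d a k q) A l
      = (kerrConnection M a l q * kerrCoframe a q + kerrCoframe_d a l q) A k := by
  obtain ⟨hS, hD, hs⟩ := hq
  have hc : Real.sin (q 2) ^ 2 = 1 - Real.cos (q 2) ^ 2 := Real.sin_sq _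
  -- The condition is symmetric in the two directions and trivial when they coincide, leaving six
  -- pairs.
  wlog hkl : k < l generalizing k l
  · rcases eq_or_lt_of_le (not_lt.mp hkl) with rfl | h
    · rfl
    · exact (this l k h).symm
  fin_cases k <;> fin_cases l <;> simp at hkl <;>
    simp only [Fin.zero_eta, Fin.mk_one, Fin.reduceFinMk, kerrConnection_0, kerrConnection_1,
      kerrConnection_2, kerrConnection_3, kerrCoframe_d_0, kerrCoframe_d_1, kerrCoframe_d_2,
      kerrCoframe_d_3] <;>
    fin_cases A <;>
    simp [kerrCoframe, connT, connR, connH, connF] <;>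
    field_simp <;> simp only [kSigma, kDelta, hc] <;> try ring

end

theorem kerr_isMovingFrame (M a : ℝ) :
    IsMovingFrame (kerrDomain M a) (kerrMetric M a) (kerrCoframe a) (kerrFrame a) (kerrEta M a)
      (kerrConnection M a) (kerrCoframe_d a) (kerrEta_d M a) where
  isOpen := kerrDomain_isOpen M a
  metric := fun _ hq => kerrMetric_eq hq
  inv_mul := fun _ hq => kerrFrame_mul_kerrCoframe hq.1
  det_ne := fun _ hq => kerrEta_det_ne hq
  symm := fun q _ => by rw [kerrEta_eq_diagonal, Matrix.diagonal_transpose]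
  hasPDeriv_coframe := fun q _ k => kerrCoframe_hasPDeriv a q k
  hasPDeriv_metric := fun q hq k => kerrEta_hasPDeriv hq k
  compat := fun _ hq k => kerrConnection_compat hq k
  torsion := fun _ hq k l A => kerrConnection_torsion hq k l A

/-! ### Curvature two-forms of Kerr, one coordinate plane at a time. -/

section

/-- The components `x^A y^B - x^B y^A`, `A < B`, of the bivector `x ∧ y`. -/
def biv {R : Type*} [CommRing R] (I : Fin 6) (x y : Fin 4 → R) : R :=
  ![x 0 * y 1 - x 1 * y 0, x 0 * y 2 - x 2 * y 0, x 0 * y 3 - x 3 * y 0,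
    x 1 * y 2 - x 2 * y 1, x 1 * y 3 - x 3 * y 1, x 2 * y 3 - x 3 * y 2] I

/-- The matrix of components of a two-form. -/
def twoForm {R : Type*} [CommRing R] (v : Fin 6 → R) : Matrix (Fin 4) (Fin 4) R :=
  !![0, v 0, v 1, v 2; -v 0, 0, v 3, v 4; -v 1, -v 3, 0, v 5; -v 2, -v 4, -v 5, 0]

/-- The real part of `M / (r - i a cos θ)³`. -/
def kerrU (M a : ℝ) (q : Fin 4 → ℝ) : ℝ :=
  M * q 1 * (q 1 ^ 2 - 3 * a ^ 2 * Real.cos (q 2) ^ 2) / kSigma a q ^ 3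

/-- The imaginary part of `M / (r - i a cos θ)³`. -/
def kerrV (M a : ℝ) (q : Fin 4 → ℝ) : ℝ :=
  M * a * Real.cos (q 2) * (3 * q 1 ^ 2 - a ^ 2 * Real.cos (q 2) ^ 2) / kSigma a q ^ 3

/-- The Riemann tensor as a bilinear form on bivectors, in the frame dual to `kerrCoframe`,
with parameters `Re Ψ₂`, `Im Ψ₂`, `sin θ`, `Σ`, `Δ`. -/
def typeDForm (u v s S D : ℝ) : Matrix (Fin 6) (Fin 6) ℝ :=
  !![-(2 * u), 0, 0, 0, 0, 2 * v * s;
     0, u * D, 0, 0, v * s, 0;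
     0, 0, u * D * s ^ 2 / S ^ 2, -(v * s), 0, 0;
     0, 0, -(v * s), -(u * S ^ 2 / D), 0, 0;
     0, v * s, 0, 0, -(u * s ^ 2 / D), 0;
     2 * v * s, 0, 0, 0, 0, 2 * u * s ^ 2]

/-- The Riemann tensor of the Kerr metric as a bilinear form on bivectors. -/
def kerrForm (M a : ℝ) (q : Fin 4 → ℝ) : Matrix (Fin 6) (Fin 6) ℝ :=
  typeDForm (kerrU M a q) (kerrV M a q) (Real.sin (q 2)) (kSigma a q) (kDelta M a q)

/-- The curvature two-form on `∂_k ∧ ∂_l`, with lowered frame indices. -/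
def kerrCurvature (M a : ℝ) (q : Fin 4 → ℝ) (k l : Fin 4) : Matrix (Fin 4) (Fin 4) ℝ :=
  twoForm (kerrForm M a q *ᵥ fun J => biv J ((kerrCoframe a q).col k) ((kerrCoframe a q).col l))

variable {M a : ℝ} {q : Fin 4 → ℝ}

theorem typeDForm_mulVec (u v s S D : ℝ) (w : Fin 6 → ℝ) :
    typeDForm u v s S D *ᵥ w =
      ![-(2 * u) * w 0 + 2 * v * s * w 5, u * D * w 1 + v * s * w 4,
        u * D * s ^ 2 / S ^ 2 * w 2 - v * s * w 3, -(v * s) * w 2 - u * S ^ 2 / D * w 3,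
        v * s * w 1 - u * s ^ 2 / D * w 4, 2 * v * s * w 0 + 2 * u * s ^ 2 * w 5] := by
  ext I
  fin_cases I <;> simp [typeDForm, Matrix.mulVec, dotProduct, Fin.sum_univ_six] <;> ring

theorem biv_kerrCoframe_tr (a : ℝ) (q : Fin 4 → ℝ) :
    (fun J => biv J ((kerrCoframe a q).col 0) ((kerrCoframe a q).col 1))
      = ![1, 0, 0, 0, a, 0] := by
  ext J
  fin_cases J <;> simp [biv, kerrCoframe]

/-- The first of six evaluations of ∂_k ω_l - ∂_l ω_k + [ω_k, ω_l], lowered with η. Here the `0` is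
the t derivative of the matrix along r; in the other planes a `0` likewise stands for a t or φ
derivative. -/
theorem kerrCurvature_tr (hq : q ∈ kerrDomain M a) :
    kerrEta M a q * (0
      - connT_dr M a (q 1) (Real.sin (q 2)) (Real.cos (q 2)) (kSigma a q) (kDelta M a q)
      + kerrConnection M a 0 q * kerrConnection M a 1 q
      - kerrConnection M a 1 q * kerrConnection M a 0 q) = kerrCurvature M a q 0 1 := by
  obtain ⟨hS, hD, hs⟩ := hq
  rw [kerrConnection_0, kerrConnection_1, kerrCurvature, kerrForm,
    biv_kerrCoframe_tr, typeDForm_mulVec]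
  ext i j
  simp only [Matrix.mul_apply, Matrix.add_apply, Matrix.sub_apply, Fin.sum_univ_four]
  fin_cases i <;> fin_cases j <;>
    simp only [Fin.zero_eta, Fin.mk_one, Fin.reduceFinMk, Fin.isValue, Matrix.of_apply,
      Matrix.cons_val', Matrix.cons_val, Matrix.zero_apply, mul_zero, zero_mul, add_zero, zero_add,
      sub_zero, zero_sub, neg_zero, mul_one, kerrEta, twoForm, kerrU, kerrV,
      connT, connR, connT_dr] <;>
    field_simp <;>
    try (simp only [kSigma, kDelta]; ring)

theorem biv_kerrCoframe_th (a : ℝ) (q : Fin 4 → ℝ) :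
    (fun J => biv J ((kerrCoframe a q).col 0) ((kerrCoframe a q).col 2))
      = ![0, 1, 0, 0, 0, a] := by
  ext J
  fin_cases J <;> simp [biv, kerrCoframe]

theorem kerrCurvature_th (hq : q ∈ kerrDomain M a) :
    kerrEta M a q * (0
      - connT_dh M a (q 1) (Real.sin (q 2)) (Real.cos (q 2)) (kSigma a q) (kDelta M a q)
      + kerrConnection M a 0 q * kerrConnection M a 2 q
      - kerrConnection M a 2 q * kerrConnection M a 0 q) = kerrCurvature M a q 0 2 := by
  obtain ⟨hS, hD, hs⟩ := hq
  rw [kerrConnection_0, kerrConnection_2, kerrCurvature, kerrForm,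
    biv_kerrCoframe_th, typeDForm_mulVec]
  ext i j
  simp only [Matrix.mul_apply, Matrix.add_apply, Matrix.sub_apply, Fin.sum_univ_four]
  fin_cases i <;> fin_cases j <;>
    simp only [Fin.zero_eta, Fin.mk_one, Fin.reduceFinMk, Fin.isValue, Matrix.of_apply,
      Matrix.cons_val', Matrix.cons_val, Matrix.zero_apply, mul_zero, zero_mul, add_zero, zero_add,
      sub_zero, zero_sub, neg_zero, mul_one, kerrEta, twoForm, kerrU, kerrV,
      connT, connH, connT_dh] <;>
    field_simp <;>
    try (simp only [kSigma]; ring)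

theorem biv_kerrCoframe_tf (a : ℝ) (q : Fin 4 → ℝ) :
    (fun J => biv J ((kerrCoframe a q).col 0) ((kerrCoframe a q).col 3))
      = ![0, 0, q 1 ^ 2 + a ^ 2 - a * (a * Real.sin (q 2) ^ 2), 0, 0, 0] := by
  ext J
  fin_cases J <;> simp [biv, kerrCoframe]

theorem kerrCurvature_tf (hq : q ∈ kerrDomain M a) :
    kerrEta M a q * (0
      - 0
      + kerrConnection M a 0 q * kerrConnection M a 3 q
      - kerrConnection M a 3 q * kerrConnection M a 0 q) = kerrCurvature M a q 0 3 := by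
  obtain ⟨hS, hD, hs⟩ := hq
  -- After expanding Σ the identity holds only modulo sin² + cos² = 1, so higher powers of the
  -- cosine are reduced to degree at most one.
  have hc2 : Real.cos (q 2) ^ 2 = 1 - Real.sin (q 2) ^ 2 := Real.cos_sq' _
  have hc3 : Real.cos (q 2) ^ 3 = (1 - Real.sin (q 2) ^ 2) * Real.cos (q 2) := by rw [← hc2]; ring
  have hc4 : Real.cos (q 2) ^ 4 = (1 - Real.sin (q 2) ^ 2) ^ 2 := by rw [← hc2]; ring
  have hc5 : Real.cos (q 2) ^ 5 = (1 - Real.sin (q 2) ^ 2) ^ 2 * Real.cos (q 2) := by rw [← hc2]; ring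
  rw [kerrConnection_0, kerrConnection_3, kerrCurvature, kerrForm,
    biv_kerrCoframe_tf, typeDForm_mulVec]
  ext i j
  simp only [Matrix.mul_apply, Matrix.add_apply, Matrix.sub_apply, Fin.sum_univ_four]
  fin_cases i <;> fin_cases j <;>
    simp only [Fin.zero_eta, Fin.mk_one, Fin.reduceFinMk, Fin.isValue, Matrix.of_apply,
      Matrix.cons_val', Matrix.cons_val, Matrix.zero_apply, mul_zero, zero_mul, add_zero, zero_add,
      sub_zero, neg_zero, kerrEta, twoForm, kerrU, kerrV,
      connT, connF] <;>
    field_simp <;>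
    try (simp only [kSigma, kDelta]; ring_nf; try (simp only [hc2, hc3, hc4, hc5]; ring))

theorem biv_kerrCoframe_rh (a : ℝ) (q : Fin 4 → ℝ) :
    (fun J => biv J ((kerrCoframe a q).col 1) ((kerrCoframe a q).col 2))
      = ![0, 0, 0, 1, 0, 0] := by
  ext J
  fin_cases J <;> simp [biv, kerrCoframe]

theorem kerrCurvature_rh (hq : q ∈ kerrDomain M a) :
    kerrEta M a q * (connH_dr M a (q 1) (Real.sin (q 2)) (Real.cos (q 2)) (kSigma a q) (kDelta M a q)
      - connR_dh a (q 1) (Real.sin (q 2)) (Real.cos (q 2)) (kSigma a q) (kDelta M a q)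
      + kerrConnection M a 1 q * kerrConnection M a 2 q
      - kerrConnection M a 2 q * kerrConnection M a 1 q) = kerrCurvature M a q 1 2 := by
  obtain ⟨hS, hD, hs⟩ := hq
  have hc2 : Real.cos (q 2) ^ 2 = 1 - Real.sin (q 2) ^ 2 := Real.cos_sq' _
  have hc3 : Real.cos (q 2) ^ 3 = (1 - Real.sin (q 2) ^ 2) * Real.cos (q 2) := by rw [← hc2]; ring
  have hc4 : Real.cos (q 2) ^ 4 = (1 - Real.sin (q 2) ^ 2) ^ 2 := by rw [← hc2]; ring
  rw [kerrConnection_1, kerrConnection_2, kerrCurvature, kerrForm,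
    biv_kerrCoframe_rh, typeDForm_mulVec]
  ext i j
  simp only [Matrix.mul_apply, Matrix.add_apply, Matrix.sub_apply, Fin.sum_univ_four]
  fin_cases i <;> fin_cases j <;>
    simp only [Fin.zero_eta, Fin.mk_one, Fin.reduceFinMk, Fin.isValue, Matrix.of_apply,
      Matrix.cons_val', Matrix.cons_val, mul_zero, zero_mul, add_zero, zero_add,
      sub_zero, zero_sub, neg_zero, mul_one, kerrEta, twoForm, kerrU, kerrV,
      connR, connH, connH_dr, connR_dh] <;>
    field_simp <;>
    try (simp only [kSigma, kDelta]; ring_nf; try (simp only [hc2, hc3, hc4]; ring))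

theorem biv_kerrCoframe_rf (a : ℝ) (q : Fin 4 → ℝ) :
    (fun J => biv J ((kerrCoframe a q).col 1) ((kerrCoframe a q).col 3))
      = ![a * Real.sin (q 2) ^ 2, 0, 0, 0, q 1 ^ 2 + a ^ 2, 0] := by
  ext J
  fin_cases J <;> simp [biv, kerrCoframe]

theorem kerrCurvature_rf (hq : q ∈ kerrDomain M a) :
    kerrEta M a q * (connF_dr M a (q 1) (Real.sin (q 2)) (Real.cos (q 2)) (kSigma a q) (kDelta M a q)
      - 0
      + kerrConnection M a 1 q * kerrConnection M a 3 q
      - kerrConnection M a 3 q * kerrConnection M a 1 q) = kerrCurvature M a q 1 3 := by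
  obtain ⟨hS, hD, hs⟩ := hq
  have hc2 : Real.cos (q 2) ^ 2 = 1 - Real.sin (q 2) ^ 2 := Real.cos_sq' _
  have hc3 : Real.cos (q 2) ^ 3 = (1 - Real.sin (q 2) ^ 2) * Real.cos (q 2) := by rw [← hc2]; ring
  have hc4 : Real.cos (q 2) ^ 4 = (1 - Real.sin (q 2) ^ 2) ^ 2 := by rw [← hc2]; ring
  have hc5 : Real.cos (q 2) ^ 5 = (1 - Real.sin (q 2) ^ 2) ^ 2 * Real.cos (q 2) := by rw [← hc2]; ring
  rw [kerrConnection_1, kerrConnection_3, kerrCurvature, kerrForm,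
    biv_kerrCoframe_rf, typeDForm_mulVec]
  ext i j
  simp only [Matrix.mul_apply, Matrix.add_apply, Matrix.sub_apply, Fin.sum_univ_four]
  fin_cases i <;> fin_cases j <;>
    simp only [Fin.zero_eta, Fin.mk_one, Fin.reduceFinMk, Fin.isValue, Matrix.of_apply,
      Matrix.cons_val', Matrix.cons_val, Matrix.zero_apply, mul_zero, zero_mul, add_zero, zero_add,
      sub_zero, zero_sub, neg_zero, kerrEta, twoForm, kerrU, kerrV,
      connR, connF, connF_dr] <;>
    field_simp <;>
    try (simp only [kSigma, kDelta]; ring_nf; try (simp only [hc2, hc3, hc4, hc5]; ring))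

theorem biv_kerrCoframe_hf (a : ℝ) (q : Fin 4 → ℝ) :
    (fun J => biv J ((kerrCoframe a q).col 2) ((kerrCoframe a q).col 3))
      = ![0, a * Real.sin (q 2) ^ 2, 0, 0, 0, q 1 ^ 2 + a ^ 2] := by
  ext J
  fin_cases J <;> simp [biv, kerrCoframe]

theorem kerrCurvature_hf (hq : q ∈ kerrDomain M a) :
    kerrEta M a q * (connF_dh M a (q 1) (Real.sin (q 2)) (Real.cos (q 2)) (kSigma a q) (kDelta M a q)
      - 0
      + kerrConnection M a 2 q * kerrConnection M a 3 q
      - kerrConnection M a 3 q * kerrConnection M a 2 q) = kerrCurvature M a q 2 3 := by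
  obtain ⟨hS, hD, hs⟩ := hq
  have hc2 : Real.cos (q 2) ^ 2 = 1 - Real.sin (q 2) ^ 2 := Real.cos_sq' _
  have hc3 : Real.cos (q 2) ^ 3 = (1 - Real.sin (q 2) ^ 2) * Real.cos (q 2) := by rw [← hc2]; ring
  have hc4 : Real.cos (q 2) ^ 4 = (1 - Real.sin (q 2) ^ 2) ^ 2 := by rw [← hc2]; ring
  have hc5 : Real.cos (q 2) ^ 5 = (1 - Real.sin (q 2) ^ 2) ^ 2 * Real.cos (q 2) := by rw [← hc2]; ring
  have hc6 : Real.cos (q 2) ^ 6 = (1 - Real.sin (q 2) ^ 2) ^ 3 := by rw [← hc2]; ring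
  rw [kerrConnection_2, kerrConnection_3, kerrCurvature, kerrForm,
    biv_kerrCoframe_hf, typeDForm_mulVec]
  ext i j
  simp only [Matrix.mul_apply, Matrix.add_apply, Matrix.sub_apply, Fin.sum_univ_four]
  fin_cases i <;> fin_cases j <;>
    simp only [Fin.zero_eta, Fin.mk_one, Fin.reduceFinMk, Fin.isValue, Matrix.of_apply,
      Matrix.cons_val', Matrix.cons_val, Matrix.zero_apply, mul_zero, zero_mul, add_zero, zero_add,
      sub_zero, neg_zero, kerrEta, twoForm, kerrU, kerrV,
      connH, connF, connF_dh] <;>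
    field_simp <;>
    try (simp only [kSigma, kDelta]; ring_nf; try (simp only [hc2, hc3, hc4, hc5, hc6]; ring))

end

/-- Every entry of the coframe depends on at most one of r and θ, so all its mixed second partials
vanish. -/
theorem kerrCoframe_d_hasPDeriv (a : ℝ) (q : Fin 4 → ℝ) {k l : Fin 4} (h : k ≠ l) :
    HasMatrixPDeriv k (kerrCoframe_d a l) 0 q := by
  refine hasMatrixPDeriv_const_of fun s => ?_
  fin_cases k <;> fin_cases l <;> simp [kerrCoframe_d_0, kerrCoframe_d_1, kerrCoframe_d_2,
    kerrCoframe_d_3] at h ⊢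

/-! ### The lowered Riemann tensor of Kerr. -/

section

variable {M a : ℝ} {q : Fin 4 → ℝ}

theorem kerrConnection_hasPDeriv_t (l : Fin 4) :
    HasMatrixPDeriv 0 (kerrConnection M a l) 0 q :=
  hasMatrixPDeriv_const_of fun s => by simp [kerrConnection]

theorem kerrConnection_hasPDeriv_f (l : Fin 4) :
    HasMatrixPDeriv 3 (kerrConnection M a l) 0 q :=
  hasMatrixPDeriv_const_of fun s => by simp [kerrConnection]

theorem kerrConnection_hasPDeriv_rt (hq : q ∈ kerrDomain M a) :
    HasMatrixPDeriv 1 (kerrConnection M a 0) (connT_dr M a (q 1) (Real.sin (q 2))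
      (Real.cos (q 2)) (kSigma a q) (kDelta M a q)) q := by
  intro i j
  have h := connT_hasDerivAt_r (a := a) (s := Real.sin (q 2)) (c := Real.cos (q 2))
    (hasDerivAt_kSigma_r a q) (hasDerivAt_kDelta_r M a q) (by simpa using hq.1)
    (by simpa using hq.2.1) hq.2.2 i j
  simpa [kerrConnection_0] using h

theorem kerrConnection_hasPDeriv_rh (hq : q ∈ kerrDomain M a) :
    HasMatrixPDeriv 1 (kerrConnection M a 2) (connH_dr M a (q 1) (Real.sin (q 2))
      (Real.cos (q 2)) (kSigma a q) (kDelta M a q)) q := by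
  intro i j
  have h := connH_hasDerivAt_r (a := a) (s := Real.sin (q 2)) (c := Real.cos (q 2))
    (hasDerivAt_kSigma_r a q) (hasDerivAt_kDelta_r M a q) (by simpa using hq.1) hq.2.2 i j
  simpa [kerrConnection_2] using h

theorem kerrConnection_hasPDeriv_rf (hq : q ∈ kerrDomain M a) :
    HasMatrixPDeriv 1 (kerrConnection M a 3) (connF_dr M a (q 1) (Real.sin (q 2))
      (Real.cos (q 2)) (kSigma a q) (kDelta M a q)) q := by
  intro i j
  have h := connF_hasDerivAt_r (a := a) (s := Real.sin (q 2)) (c := Real.cos (q 2))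
    (hasDerivAt_kSigma_r a q) (hasDerivAt_kDelta_r M a q) (by simpa using hq.1)
    (by simpa using hq.2.1) hq.2.2 i j
  simpa [kerrConnection_3] using h

theorem kerrConnection_hasPDeriv_ht (hq : q ∈ kerrDomain M a) :
    HasMatrixPDeriv 2 (kerrConnection M a 0) (connT_dh M a (q 1) (Real.sin (q 2))
      (Real.cos (q 2)) (kSigma a q) (kDelta M a q)) q := by
  intro i j
  have h := connT_hasDerivAt_h (M := M) (r := q 1) (hasDerivAt_kSigma_h a q)
    (by simpa using hq.1) hq.2.1 hq.2.2 i j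
  simpa [kerrConnection_0] using h

theorem kerrConnection_hasPDeriv_hr (hq : q ∈ kerrDomain M a) :
    HasMatrixPDeriv 2 (kerrConnection M a 1) (connR_dh a (q 1) (Real.sin (q 2))
      (Real.cos (q 2)) (kSigma a q) (kDelta M a q)) q := by
  intro i j
  have h := connR_hasDerivAt_h (M := M) (r := q 1) (hasDerivAt_kSigma_h a q)
    (by simpa using hq.1) hq.2.1 i j
  simpa [kerrConnection_1] using h

theorem kerrConnection_hasPDeriv_hf (hq : q ∈ kerrDomain M a) :
    HasMatrixPDeriv 2 (kerrConnection M a 3) (connF_dh M a (q 1) (Real.sin (q 2))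
      (Real.cos (q 2)) (kSigma a q) (kDelta M a q)) q := by
  intro i j
  have h := connF_hasDerivAt_h (M := M) (r := q 1) (hasDerivAt_kSigma_h a q)
    (by simpa using hq.1) hq.2.1 hq.2.2 i j
  simpa [kerrConnection_3] using h

/-- Since g = fᵀηf and f R = Ω f, lowering gives g R = fᵀ(ηΩ)f. -/
theorem kerrMetric_mul_riemannMatrix_of (hq : q ∈ kerrDomain M a) {k l : Fin 4} (hkl : k ≠ l)
    {A B : Matrix (Fin 4) (Fin 4) ℝ} (hA : HasMatrixPDeriv k (kerrConnection M a l) A q)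
    (hB : HasMatrixPDeriv l (kerrConnection M a k) B q)
    (h : kerrEta M a q * (A - B + kerrConnection M a k q * kerrConnection M a l q
      - kerrConnection M a l q * kerrConnection M a k q) = kerrCurvature M a q k l) :
    kerrMetric M a q * riemannMatrix (kerrMetric M a) q k l
      = (kerrCoframe a q)ᵀ * kerrCurvature M a q k l * kerrCoframe a q := by
  obtain ⟨Fk, hFk⟩ := kerrFrame_hasPDeriv hq.1 k
  obtain ⟨Fl, hFl⟩ := kerrFrame_hasPDeriv hq.1 l
  have := (kerr_isMovingFrame M a).mul_riemannMatrix hq hA hB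
    (kerrCoframe_d_hasPDeriv a q hkl) (kerrCoframe_d_hasPDeriv a q hkl.symm) hFk hFl
  rw [kerrMetric_eq hq, Matrix.mul_assoc, this, ← h]
  simp only [Matrix.mul_assoc]

theorem biv_swap {R : Type*} [CommRing R] (I : Fin 6) (x y : Fin 4 → R) :
    biv I x y = -biv I y x := by
  fin_cases I <;> simp [biv] <;> ring

theorem twoForm_neg {R : Type*} [CommRing R] (v : Fin 6 → R) : twoForm (-v) = -twoForm v := by
  ext i j
  fin_cases i <;> fin_cases j <;> simp [twoForm]

theorem kerrCurvature_swap (k l : Fin 4) : kerrCurvature M a q k l = -kerrCurvature M a q l k := by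
  rw [kerrCurvature, kerrCurvature, ← twoForm_neg, ← Matrix.mulVec_neg]
  congr 2
  ext J
  exact biv_swap _ _ _

theorem kerrCurvature_self (k : Fin 4) : kerrCurvature M a q k k = 0 := by
  ext i j
  have h := congrFun (congrFun (kerrCurvature_swap (M := M) (a := a) (q := q) k k) i) j
  simpa using self_eq_neg.mp h

theorem riemannMatrix_swap (g : (Fin 4 → ℝ) → Matrix (Fin 4) (Fin 4) ℝ) (p : Fin 4 → ℝ)
    (k l : Fin 4) : riemannMatrix g p k l = -riemannMatrix g p l k := by
  ext i j
  simp only [riemannMatrix, riemannUp, Matrix.of_apply, Matrix.neg_apply]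
  ring

/-- The curvature of the Kerr metric with all indices lowered. -/
theorem kerrMetric_mul_riemannMatrix (hq : q ∈ kerrDomain M a) (k l : Fin 4) :
    kerrMetric M a q * riemannMatrix (kerrMetric M a) q k l
      = (kerrCoframe a q)ᵀ * kerrCurvature M a q k l * kerrCoframe a q := by
  wlog hkl : k < l generalizing k l
  · rcases eq_or_lt_of_le (not_lt.mp hkl) with rfl | h
    · rw [riemannMatrix_self, kerrCurvature_self, Matrix.mul_zero, Matrix.mul_zero,
        Matrix.zero_mul]
    · rw [riemannMatrix_swap, kerrCurvature_swap, Matrix.mul_neg, Matrix.mul_neg, Matrix.neg_mul,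
        this l k h]
  fin_cases k <;> fin_cases l <;> simp at hkl
  · exact kerrMetric_mul_riemannMatrix_of hq (by decide) (kerrConnection_hasPDeriv_t 1)
      (kerrConnection_hasPDeriv_rt hq) (kerrCurvature_tr hq)
  · exact kerrMetric_mul_riemannMatrix_of hq (by decide) (kerrConnection_hasPDeriv_t 2)
      (kerrConnection_hasPDeriv_ht hq) (kerrCurvature_th hq)
  · exact kerrMetric_mul_riemannMatrix_of hq (by decide) (kerrConnection_hasPDeriv_t 3)
      (kerrConnection_hasPDeriv_f 0) (kerrCurvature_tf hq)
  · exact kerrMetric_mul_riemannMatrix_of hq (by decide) (kerrConnection_hasPDeriv_rh hq)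
      (kerrConnection_hasPDeriv_hr hq) (kerrCurvature_rh hq)
  · exact kerrMetric_mul_riemannMatrix_of hq (by decide) (kerrConnection_hasPDeriv_rf hq)
      (kerrConnection_hasPDeriv_f 1) (kerrCurvature_rf hq)
  · exact kerrMetric_mul_riemannMatrix_of hq (by decide) (kerrConnection_hasPDeriv_hf hq)
      (kerrConnection_hasPDeriv_f 2) (kerrCurvature_hf hq)

end

/-! ### Forms on bivectors and their multilinear expansion. -/

section

variable {R : Type*} [CommRing R]

/-- The bivector `x ∧ y`. -/
def bivec (x y : Fin 4 → R) : Fin 6 → R := fun I => biv I x y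

theorem bivec_mulVec_left (f : Matrix (Fin 4) (Fin 4) R) (u y : Fin 4 → R) :
    bivec (f *ᵥ u) y = ∑ i, u i • bivec (f.col i) y := by
  ext I
  fin_cases I <;> simp [bivec, biv, Matrix.mulVec, dotProduct, Fin.sum_univ_four] <;> ring

theorem bivec_mulVec_right (f : Matrix (Fin 4) (Fin 4) R) (x v : Fin 4 → R) :
    bivec x (f *ᵥ v) = ∑ j, v j • bivec x (f.col j) := by
  ext I
  fin_cases I <;> simp [bivec, biv, Matrix.mulVec, dotProduct, Fin.sum_univ_four] <;> ring

theorem dotProduct_twoForm_mulVec (v : Fin 6 → R) (x y : Fin 4 → R) :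
    x ⬝ᵥ twoForm v *ᵥ y = bivec x y ⬝ᵥ v := by
  simp [twoForm, bivec, biv, Matrix.mulVec, dotProduct, Fin.sum_univ_four, Fin.sum_univ_six]
  ring

/-- The quadrilinear form given by a bilinear form on bivectors. -/
def bivForm (S : Matrix (Fin 6) (Fin 6) R) (x y z w : Fin 4 → R) : R :=
  bivec x y ⬝ᵥ S *ᵥ bivec z w

section

variable (S : Matrix (Fin 6) (Fin 6) R) (f : Matrix (Fin 4) (Fin 4) R) (u x y z w : Fin 4 → R)

theorem bivForm_mulVec_fst :
    bivForm S (f *ᵥ u) y z w = ∑ i, u i * bivForm S (f.col i) y z w := by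
  simp only [bivForm, bivec_mulVec_left, sum_dotProduct, smul_dotProduct, smul_eq_mul]

theorem bivForm_mulVec_snd :
    bivForm S x (f *ᵥ u) z w = ∑ i, u i * bivForm S x (f.col i) z w := by
  simp only [bivForm, bivec_mulVec_right, sum_dotProduct, smul_dotProduct, smul_eq_mul]

theorem bivForm_mulVec_trd :
    bivForm S x y (f *ᵥ u) w = ∑ i, u i * bivForm S x y (f.col i) w := by
  simp only [bivForm, bivec_mulVec_left, Matrix.mulVec_sum, Matrix.mulVec_smul, dotProduct_sum,
    dotProduct_smul, smul_eq_mul]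

theorem bivForm_mulVec_fth :
    bivForm S x y z (f *ᵥ u) = ∑ i, u i * bivForm S x y z (f.col i) := by
  simp only [bivForm, bivec_mulVec_right, Matrix.mulVec_sum, Matrix.mulVec_smul, dotProduct_sum,
    dotProduct_smul, smul_eq_mul]

end

/-- Passes between coordinate components and frame vectors. It is stated over a commutative ring
because it serves both real vectors and the complexified tetrad. -/
theorem bivForm_mulVec (S : Matrix (Fin 6) (Fin 6) R) (f : Matrix (Fin 4) (Fin 4) R)
    (u v w z : Fin 4 → R) :
    bivForm S (f *ᵥ u) (f *ᵥ v) (f *ᵥ w) (f *ᵥ z) =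
      ∑ i, ∑ j, ∑ k, ∑ l,
        bivForm S (f.col i) (f.col j) (f.col k) (f.col l) * u i * v j * w k * z l := by
  rw [bivForm_mulVec_fst]
  refine Finset.sum_congr rfl fun i _ => ?_
  rw [bivForm_mulVec_snd, Finset.mul_sum]
  refine Finset.sum_congr rfl fun j _ => ?_
  rw [bivForm_mulVec_trd, Finset.mul_sum, Finset.mul_sum]
  refine Finset.sum_congr rfl fun k _ => ?_
  rw [bivForm_mulVec_fth, Finset.mul_sum, Finset.mul_sum, Finset.mul_sum]
  exact Finset.sum_congr rfl fun l _ => by ring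

end

/-! ### Ricci flatness, the Weyl tensor and the curvature operator. -/

section

variable {M a : ℝ} {q : Fin 4 → ℝ}

/-- The columns of the coframe matrix are the frame components of the coordinate vectors. -/
theorem kerr_riemannDown (hq : q ∈ kerrDomain M a) (i j k l : Fin 4) :
    riemannDown (kerrMetric M a) q i j k l = bivForm (kerrForm M a q) ((kerrCoframe a q).col i)
      ((kerrCoframe a q).col j) ((kerrCoframe a q).col k) ((kerrCoframe a q).col l) := by
  have h := congrFun (congrFun (kerrMetric_mul_riemannMatrix hq k l) i) j
  rw [Matrix.mul_assoc] at h
  exact h.trans (dotProduct_twoForm_mulVec _ _ _)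

/-- The inverse of `kerrEta`, as a vector of diagonal entries. -/
def kerrEtaInv (M a : ℝ) (q : Fin 4 → ℝ) : Fin 4 → ℝ :=
  ![-(kSigma a q / kDelta M a q), kDelta M a q / kSigma a q, (kSigma a q)⁻¹,
    kSigma a q / Real.sin (q 2) ^ 2]

theorem kerrEtaInv_mul_kerrEta (hq : q ∈ kerrDomain M a) :
    Matrix.diagonal (kerrEtaInv M a q) * kerrEta M a q = 1 := by
  obtain ⟨hS, hD, hs⟩ := hq
  rw [kerrEta_eq_diagonal, Matrix.diagonal_mul_diagonal, ← Matrix.diagonal_one]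
  congr 1
  ext A
  fin_cases A <;> simp [kerrEtaInv] <;> field_simp

theorem kerrCoframe_mul_kerrFrame (hS : kSigma a q ≠ 0) :
    kerrCoframe a q * kerrFrame a q = 1 :=
  mul_eq_one_comm.mp (kerrFrame_mul_kerrCoframe hS)

theorem kerrMetric_inv (hq : q ∈ kerrDomain M a) :
    (kerrMetric M a q)⁻¹
      = kerrFrame a q * Matrix.diagonal (kerrEtaInv M a q) * (kerrFrame a q)ᵀ := by
  refine Matrix.inv_eq_left_inv ?_
  have h1 : (kerrFrame a q)ᵀ * (kerrCoframe a q)ᵀ = 1 := by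
    rw [← Matrix.transpose_mul, kerrCoframe_mul_kerrFrame hq.1, Matrix.transpose_one]
  calc _ = kerrFrame a q * (Matrix.diagonal (kerrEtaInv M a q)
        * (((kerrFrame a q)ᵀ * (kerrCoframe a q)ᵀ) * kerrEta M a q)) * kerrCoframe a q := by
        rw [kerrMetric_eq hq]; noncomm_ring
    _ = 1 := by
        rw [h1, Matrix.one_mul, kerrEtaInv_mul_kerrEta hq, Matrix.mul_one,
          kerrFrame_mul_kerrCoframe hq.1]

/-- The coefficient v couples only complementary planes, which share no index, so it never enters a
trace. For each frame direction the three planes containing it contribute u in proportion 2 : -1 :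
-1, hence zero. -/
theorem kerrForm_trace (hq : q ∈ kerrDomain M a) (x y : Fin 4 → ℝ) :
    ∑ A, kerrEtaInv M a q A * bivForm (kerrForm M a q) (Pi.single A 1) x (Pi.single A 1) y = 0 := by
  obtain ⟨hS, hD, hs⟩ := hq
  simp [Fin.sum_univ_four, Fin.sum_univ_six, bivForm, kerrForm, typeDForm_mulVec, bivec, biv,
    kerrEtaInv, dotProduct]
  field_simp
  ring

/-- The Kerr metric is Ricci flat. -/
theorem kerr_ricci (hq : q ∈ kerrDomain M a) (i k : Fin 4) :
    ricci (kerrMetric M a) q i k = 0 := by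
  set f := kerrCoframe a q with hf
  set S := kerrForm M a q with hS
  have hup : ∀ m, riemannUp (kerrMetric M a) q m i m k
      = ∑ n, (kerrMetric M a q)⁻¹ m n * bivForm S (f.col n) (f.col i) (f.col m) (f.col k) := by
    intro m
    have h1 := congrFun (congrFun (Matrix.nonsing_inv_mul_cancel_left _
      (riemannMatrix (kerrMetric M a) q m k) ((kerr_isMovingFrame M a).isUnit_det hq)) m) i
    rw [Matrix.mul_apply] at h1
    refine h1.symm.trans (Finset.sum_congr rfl fun n _ => ?_)
    rw [← kerr_riemannDown hq]
    rfl
  have hcol : ∀ A, f *ᵥ (kerrFrame a q).col A = Pi.single A 1 := by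
    intro A
    rw [← Matrix.mulVec_single_one, Matrix.mulVec_mulVec, kerrCoframe_mul_kerrFrame hq.1,
      Matrix.one_mulVec]
  have hinv : ∀ m n, (kerrMetric M a q)⁻¹ m n
      = ∑ A, kerrFrame a q m A * kerrEtaInv M a q A * kerrFrame a q n A := by
    intro m n
    rw [kerrMetric_inv hq, Matrix.mul_apply]
    simp only [Matrix.mul_diagonal, Matrix.transpose_apply]
  -- The coordinate trace becomes the frame trace because g⁻¹ = F η⁻¹ Fᵀ and the coframe sends the
  -- columns of F to the standard basis.
  rw [← kerrForm_trace hq (f.col i) (f.col k), ricci]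
  simp only [hup, ← hcol, bivForm_mulVec_fst, bivForm_mulVec_trd, Finset.mul_sum, hinv,
    Finset.sum_mul]
  conv_rhs => rw [Finset.sum_comm]
  refine Finset.sum_congr rfl fun n _ => ?_
  rw [Finset.sum_comm]
  refine Finset.sum_congr rfl fun A _ => Finset.sum_congr rfl fun m _ => ?_
  simp only [Matrix.col_apply]
  ring

theorem kerr_weyl (hq : q ∈ kerrDomain M a) (i j k l : Fin 4) :
    weyl (kerrMetric M a) q i j k l = bivForm (kerrForm M a q) ((kerrCoframe a q).col i)
      ((kerrCoframe a q).col j) ((kerrCoframe a q).col k) ((kerrCoframe a q).col l) := by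
  simp [weyl, ricciScalar, kerr_ricci hq, kerr_riemannDown hq]

/-- The Weyl tensor of the Kerr metric in the complexified frame. -/
theorem kerr_weylC (hq : q ∈ kerrDomain M a) (u v w z : Fin 4 → ℂ) :
    weylC (kerrMetric M a) q u v w z =
      bivForm ((kerrForm M a q).map Complex.ofReal)
        ((kerrCoframe a q).map Complex.ofReal *ᵥ u) ((kerrCoframe a q).map Complex.ofReal *ᵥ v)
        ((kerrCoframe a q).map Complex.ofReal *ᵥ w)
        ((kerrCoframe a q).map Complex.ofReal *ᵥ z) := by
  have hb : ∀ x y : Fin 4 → ℝ, bivec (fun i => (x i : ℂ)) (fun i => (y i : ℂ))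
      = fun I => ((bivec x y I : ℝ) : ℂ) := by
    intro x y
    ext I
    fin_cases I <;> simp [bivec, biv]
  have hc : ∀ i, ((kerrCoframe a q).map Complex.ofReal).col i
      = fun A => ((kerrCoframe a q).col i A : ℂ) := fun i => rfl
  rw [bivForm_mulVec, weylC]
  simp only [kerr_weyl hq, bivForm, hc, hb]
  simp [dotProduct, Matrix.mulVec]

/-- The curvature operator of the Kerr metric in the frame. -/
theorem kerr_curvOp (hq : q ∈ kerrDomain M a) (X Y Z : Fin 4 → ℝ) :
    kerrEta M a q *ᵥ (kerrCoframe a q *ᵥ curvOp (kerrMetric M a) q Y Z X)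
      = twoForm (kerrForm M a q *ᵥ bivec (kerrCoframe a q *ᵥ Y) (kerrCoframe a q *ᵥ Z))
        *ᵥ (kerrCoframe a q *ᵥ X) := by
  have h1 : ∀ V, V ⬝ᵥ kerrMetric M a q *ᵥ curvOp (kerrMetric M a) q Y Z X
      = bivForm (kerrForm M a q) (kerrCoframe a q *ᵥ V) (kerrCoframe a q *ᵥ X)
        (kerrCoframe a q *ᵥ Y) (kerrCoframe a q *ᵥ Z) := by
    intro V
    rw [bivForm_mulVec]
    simp only [← kerr_riemannDown hq]
    simp only [riemannDown, curvOp, dotProduct, Matrix.mulVec, Finset.mul_sum, Finset.sum_mul]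
    refine Finset.sum_congr rfl fun i _ => ?_
    rw [Finset.sum_comm]
    refine Finset.sum_congr rfl fun j _ => ?_
    rw [Finset.sum_comm]
    refine Finset.sum_congr rfl fun k _ => ?_
    rw [Finset.sum_comm]
    refine Finset.sum_congr rfl fun l _ => Finset.sum_congr rfl fun h _ => ?_
    ring
  have h2 : kerrCoframe a q * kerrFrame a q = 1 := kerrCoframe_mul_kerrFrame hq.1
  -- Both sides are covectors in the frame; they are compared by pairing with an arbitrary w,
  -- realized as the frame components of V = F w.
  refine dotProduct_eq _ _ fun w => ?_
  have h3 := h1 (kerrFrame a q *ᵥ w)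
  rw [Matrix.mulVec_mulVec, h2, Matrix.one_mulVec, bivForm, ← dotProduct_twoForm_mulVec,
    kerrMetric_eq hq] at h3
  rw [dotProduct_comm, dotProduct_comm _ w, ← h3, ← Matrix.mulVec_mulVec,
    ← Matrix.mulVec_mulVec, Matrix.dotProduct_mulVec _ (kerrCoframe a q)ᵀ, Matrix.vecMul_transpose,
    Matrix.mulVec_mulVec w, h2, Matrix.one_mulVec]

theorem kerr_inner4 (hq : q ∈ kerrDomain M a) (X Y : Fin 4 → ℝ) :
    inner4 (kerrMetric M a) q X Y
      = (kerrCoframe a q *ᵥ X) ⬝ᵥ kerrEta M a q *ᵥ (kerrCoframe a q *ᵥ Y) := by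
  have h : inner4 (kerrMetric M a) q X Y = X ⬝ᵥ kerrMetric M a q *ᵥ Y := by
    simp only [inner4, dotProduct, Matrix.mulVec, Finset.mul_sum]
    exact Finset.sum_congr rfl fun i _ => Finset.sum_congr rfl fun j _ => by ring
  rw [h, kerrMetric_eq hq, ← Matrix.mulVec_mulVec, ← Matrix.mulVec_mulVec,
    Matrix.dotProduct_mulVec _ (kerrCoframe a q)ᵀ, Matrix.vecMul_transpose]

theorem kerr_innerC (hq : q ∈ kerrDomain M a) (u v : Fin 4 → ℂ) :
    innerC (kerrMetric M a) q u v
      = ((kerrCoframe a q).map Complex.ofReal *ᵥ u) ⬝ᵥ (kerrEta M a q).map Complex.ofReal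
        *ᵥ ((kerrCoframe a q).map Complex.ofReal *ᵥ v) := by
  have h : innerC (kerrMetric M a) q u v
      = u ⬝ᵥ (kerrMetric M a q).map Complex.ofReal *ᵥ v := by
    simp only [innerC, dotProduct, Matrix.mulVec, Finset.mul_sum, Matrix.map_apply]
    exact Finset.sum_congr rfl fun i _ => Finset.sum_congr rfl fun j _ => by ring
  have h2 : (kerrMetric M a q).map Complex.ofReal = ((kerrCoframe a q).map Complex.ofReal)ᵀ
      * (kerrEta M a q).map Complex.ofReal * (kerrCoframe a q).map Complex.ofReal := by
    rw [kerrMetric_eq hq]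
    ext i j
    simp [Matrix.mul_apply]
  rw [h, h2, ← Matrix.mulVec_mulVec, ← Matrix.mulVec_mulVec,
    Matrix.dotProduct_mulVec _ ((kerrCoframe a q).map Complex.ofReal)ᵀ, Matrix.vecMul_transpose]

end

/-! ### The null tetrad in the coframe and the Weyl scalars. -/

/-- The complexified matrix of `kerrCoframe`. -/
def kerrCoframeC (a : ℝ) (q : Fin 4 → ℝ) : Matrix (Fin 4) (Fin 4) ℂ :=
  (kerrCoframe a q).map Complex.ofReal

/-- The normalization factor of the vector `m`. -/
def kerrMu (a : ℝ) (q : Fin 4 → ℝ) : ℂ :=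
  1 / ((Real.sqrt 2 : ℂ) * ((q 1 : ℂ) + Complex.I * a * Real.cos (q 2)))

section

variable {M a : ℝ} {q : Fin 4 → ℝ}

theorem add_mul_sub_eq_kSigma (a : ℝ) (q : Fin 4 → ℝ) :
    ((q 1 : ℂ) + Complex.I * a * Real.cos (q 2)) * ((q 1 : ℂ) - Complex.I * a * Real.cos (q 2))
      = (kSigma a q : ℂ) := by
  simp only [kSigma, Complex.ofReal_add, Complex.ofReal_mul, Complex.ofReal_pow]
  linear_combination -(a : ℂ) ^ 2 * (Real.cos (q 2) : ℂ) ^ 2 * Complex.I_sq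

/-- Comes from |r + ia cos θ|² = Σ. It is the only fact about the factor of m that the tetrad and
curvature computations use. -/
theorem kerrMu_mul_star (a : ℝ) (q : Fin 4 → ℝ) :
    kerrMu a q * star (kerrMu a q) = 1 / (2 * (kSigma a q : ℂ)) := by
  have h2 : ((Real.sqrt 2 : ℝ) : ℂ) * ((Real.sqrt 2 : ℝ) : ℂ) = 2 := by
    rw [← Complex.ofReal_mul, Real.mul_self_sqrt zero_le_two, Complex.ofReal_ofNat]
  have h3 : star (kerrMu a q)
      = 1 / ((Real.sqrt 2 : ℂ) * ((q 1 : ℂ) - Complex.I * a * Real.cos (q 2))) := by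
    simp only [kerrMu, Complex.star_def, map_div₀, map_mul, map_add, map_one, Complex.conj_ofReal,
      Complex.conj_I]
    ring
  rw [h3, kerrMu, div_mul_div_comm, mul_mul_mul_comm, h2, add_mul_sub_eq_kSigma, one_mul]

theorem kerrCoframeC_mulVec_toC (X : Fin 4 → ℝ) :
    kerrCoframeC a q *ᵥ toC X = toC (kerrCoframe a q *ᵥ X) := by
  ext A
  simp [kerrCoframeC, toC, Matrix.mulVec, dotProduct]

theorem kerrCoframeC_mulVec_star (u : Fin 4 → ℂ) :
    kerrCoframeC a q *ᵥ star u = star (kerrCoframeC a q *ᵥ u) := by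
  ext A
  simp [kerrCoframeC, Matrix.mulVec, dotProduct]

/-- The t and φ components are in the ratio (r² + a²) : a, which the fourth covector (r² + a²) dφ -
a dt annihilates; the same holds for n. -/
theorem kerrCoframe_mulVec_l (hD : kDelta M a q ≠ 0) :
    kerrCoframe a q *ᵥ (kerrTetrad M a q).l = ![kSigma a q / kDelta M a q, 1, 0, 0] := by
  have hc : Real.sin (q 2) ^ 2 = 1 - Real.cos (q 2) ^ 2 := Real.sin_sq _
  ext A
  fin_cases A <;> simp [kerrCoframe, kerrTetrad] <;> field_simp
  · simp only [hc, kSigma]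
    ring
  · ring

theorem kerrCoframe_mulVec_n (hS : kSigma a q ≠ 0) :
    kerrCoframe a q *ᵥ (kerrTetrad M a q).n
      = ![1 / 2, -(kDelta M a q / (2 * kSigma a q)), 0, 0] := by
  have hc : Real.sin (q 2) ^ 2 = 1 - Real.cos (q 2) ^ 2 := Real.sin_sq _
  ext A
  fin_cases A <;> simp [kerrCoframe, kerrTetrad] <;> field_simp
  · simp only [hc, kSigma]
    ring
  · ring

theorem kerrCoframeC_mulVec_m (hs : Real.sin (q 2) ≠ 0) :
    kerrCoframeC a q *ᵥ (kerrTetrad M a q).m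
      = kerrMu a q • ![0, 0, 1, Complex.I * kSigma a q / Real.sin (q 2)] := by
  have hs' : (Real.sin (q 2) : ℂ) ≠ 0 := Complex.ofReal_ne_zero.mpr hs
  have hS : (kSigma a q : ℂ) = (q 1 : ℂ) ^ 2 + (a : ℂ) ^ 2 - a ^ 2 * (Real.sin (q 2) : ℂ) ^ 2 := by
    have : kSigma a q = q 1 ^ 2 + a ^ 2 - a ^ 2 * Real.sin (q 2) ^ 2 := by
      rw [Real.sin_sq, kSigma]; ring
    rw [this]
    simp only [Complex.ofReal_add, Complex.ofReal_sub, Complex.ofReal_mul, Complex.ofReal_pow]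
  have hm : (kerrTetrad M a q).m = kerrMu a q •
      ![Complex.I * a * Real.sin (q 2), 0, 1, Complex.I / Real.sin (q 2)] := rfl
  rw [hm, Matrix.mulVec_smul, hS]
  congr 1
  ext A
  fin_cases A <;>
    simp [-Complex.ofReal_sin, kerrCoframeC, kerrCoframe, Matrix.mulVec, dotProduct,
      Fin.sum_univ_four] <;> field_simp <;> ring

theorem typeDForm_map_mulVec (u v s S D : ℝ) (w : Fin 6 → ℂ) :
    (typeDForm u v s S D).map Complex.ofReal *ᵥ w =
      ![-(2 * u) * w 0 + 2 * v * s * w 5, u * D * w 1 + v * s * w 4,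
        u * D * s ^ 2 / S ^ 2 * w 2 - v * s * w 3, -(v * s) * w 2 - u * S ^ 2 / D * w 3,
        v * s * w 1 - u * s ^ 2 / D * w 4, 2 * v * s * w 0 + 2 * u * s ^ 2 * w 5] := by
  ext I
  fin_cases I <;> simp [typeDForm, Matrix.mulVec, dotProduct, Fin.sum_univ_six] <;> ring

theorem kerrEta_map (M a : ℝ) (q : Fin 4 → ℝ) :
    (kerrEta M a q).map Complex.ofReal = Matrix.diagonal ![-((kDelta M a q : ℂ) / kSigma a q),
      (kSigma a q : ℂ) / kDelta M a q, (kSigma a q : ℂ),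
      (Real.sin (q 2) : ℂ) ^ 2 / kSigma a q] := by
  ext i j
  fin_cases i <;> fin_cases j <;> simp [-Complex.ofReal_sin, kerrEta]

/-- The components of the null tetrad in the complexified coframe. -/
theorem kerrCoframeC_mulVec_frame (hq : q ∈ kerrDomain M a) (A : Fin 4) :
    kerrCoframeC a q *ᵥ (kerrTetrad M a q).frame A =
      (![![(kSigma a q : ℂ) / kDelta M a q, 1, 0, 0],
        ![1 / 2, -((kDelta M a q : ℂ) / (2 * kSigma a q)), 0, 0],
        ![0, 0, kerrMu a q, kerrMu a q * (Complex.I * kSigma a q / Real.sin (q 2))],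
        ![0, 0, star (kerrMu a q),
          -(star (kerrMu a q) * (Complex.I * kSigma a q / Real.sin (q 2)))]] :
        Fin 4 → Fin 4 → ℂ) A := by
  obtain ⟨hS, hD, hs⟩ := hq
  have h0 : kerrCoframeC a q *ᵥ toC (kerrTetrad M a q).l
      = ![(kSigma a q : ℂ) / kDelta M a q, 1, 0, 0] := by
    rw [kerrCoframeC_mulVec_toC, kerrCoframe_mulVec_l hD]
    ext B
    fin_cases B <;> simp [toC]
  have h1 : kerrCoframeC a q *ᵥ toC (kerrTetrad M a q).n
      = ![1 / 2, -((kDelta M a q : ℂ) / (2 * kSigma a q)), 0, 0] := by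
    rw [kerrCoframeC_mulVec_toC, kerrCoframe_mulVec_n hS]
    ext B
    fin_cases B <;> simp [toC]
  have h3 : kerrCoframeC a q *ᵥ star (kerrTetrad M a q).m = ![0, 0, star (kerrMu a q),
      -(star (kerrMu a q) * (Complex.I * kSigma a q / Real.sin (q 2)))] := by
    rw [kerrCoframeC_mulVec_star, kerrCoframeC_mulVec_m hs]
    ext B
    fin_cases B <;> simp [-Complex.ofReal_sin, Complex.conj_ofReal]
    ring
  fin_cases A
  · exact h0
  · exact h1
  · refine (kerrCoframeC_mulVec_m hs).trans ?_
    ext B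
    fin_cases B <;> simp [-Complex.ofReal_sin]
  · exact h3

theorem kerrTetrad_isNull (hq : q ∈ kerrDomain M a) :
    (kerrTetrad M a q).IsNull (kerrMetric M a) q := by
  intro A B
  have hS : (kSigma a q : ℂ) ≠ 0 := Complex.ofReal_ne_zero.mpr hq.1
  have hD : (kDelta M a q : ℂ) ≠ 0 := Complex.ofReal_ne_zero.mpr hq.2.1
  have hs : (Real.sin (q 2) : ℂ) ≠ 0 := Complex.ofReal_ne_zero.mpr hq.2.2
  have hm := kerrMu_mul_star a q
  have e1 := kerrCoframeC_mulVec_frame hq A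
  have e2 := kerrCoframeC_mulVec_frame hq B
  rw [kerrCoframeC] at e1 e2
  rw [kerr_innerC hq, e1, e2, kerrEta_map]
  -- The factor and its conjugate become independent letters tied only by `hm`, so every product of
  -- tetrad vectors is a rational identity.
  generalize kerrMu a q = μ at *
  generalize (kSigma a q : ℂ) = S at *
  generalize (kDelta M a q : ℂ) = D at *
  generalize (Real.sin (q 2) : ℂ) = s at *
  generalize star μ = ν at *
  have hI : Complex.I ^ 2 = -1 := Complex.I_sq
  field_simp at hm
  clear e1 e2
  fin_cases A <;> fin_cases B <;>
    simp [dotProduct, Matrix.mulVec_diagonal, Fin.sum_univ_four] <;> field_simp <;>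
    (try simp only [hI]) <;> (try ring_nf) <;> try linear_combination hm

/-- `Ψ₂` of the Kerr metric. -/
theorem kerrU_add_kerrV_mul_I (M : ℝ) (hS : kSigma a q ≠ 0) :
    (kerrU M a q : ℂ) + kerrV M a q * Complex.I
      = (M : ℂ) / ((q 1 : ℂ) - Complex.I * a * Real.cos (q 2)) ^ 3 := by
  have h := add_mul_sub_eq_kSigma a q
  have hS' : (kSigma a q : ℂ) ≠ 0 := Complex.ofReal_ne_zero.mpr hS
  have hne : ((q 1 : ℂ) - Complex.I * a * Real.cos (q 2)) ≠ 0 := by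
    intro h0
    rw [h0, mul_zero] at h
    exact hS' h.symm
  have hne' : ((q 1 : ℂ) + Complex.I * a * Real.cos (q 2)) ≠ 0 := by
    intro h0
    rw [h0, zero_mul] at h
    exact hS' h.symm
  have hI2 : Complex.I ^ 2 = -1 := Complex.I_sq
  have hI3 : Complex.I ^ 3 = -Complex.I := Complex.I_pow_three
  -- Numerator and denominator are multiplied by (r + ia cos θ)³, whose real and imaginary parts are
  -- the numerators of u and v up to the factor M.
  have h1 : (kerrU M a q : ℂ) + kerrV M a q * Complex.I
      = M * ((q 1 : ℂ) + Complex.I * a * Real.cos (q 2)) ^ 3 / (kSigma a q : ℂ) ^ 3 := by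
    simp only [kerrU, kerrV, Complex.ofReal_sub, Complex.ofReal_mul,
      Complex.ofReal_div, Complex.ofReal_pow, Complex.ofReal_ofNat]
    field_simp
    ring_nf
    simp only [hI2, hI3]
    ring
  rw [h1, ← h]
  field_simp

/-- The components of the null tetrad in the complexified coframe. -/
def kerrTetradComponents (M a : ℝ) (q : Fin 4 → ℝ) (A : Fin 4) : Fin 4 → ℂ :=
  kerrCoframeC a q *ᵥ (kerrTetrad M a q).frame A

theorem kerr_weylC_frame (hq : q ∈ kerrDomain M a) (A B C D : Fin 4) :
    weylC (kerrMetric M a) q ((kerrTetrad M a q).frame A) ((kerrTetrad M a q).frame B)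
      ((kerrTetrad M a q).frame C) ((kerrTetrad M a q).frame D)
      = bivec (kerrTetradComponents M a q A) (kerrTetradComponents M a q B) ⬝ᵥ
        (typeDForm (kerrU M a q) (kerrV M a q) (Real.sin (q 2)) (kSigma a q)
          (kDelta M a q)).map Complex.ofReal *ᵥ
        bivec (kerrTetradComponents M a q C) (kerrTetradComponents M a q D) :=
  kerr_weylC hq _ _ _ _

/-- Ψ₁ and Ψ₃ pair l∧n, which lies in the first plane, with a bivector mixing the two planes, and
the form does not couple these. In Ψ₀ and Ψ₄ the contributions cancel because the real and imaginary
legs of m are orthogonal of equal length. Only Ψ₂ uses the normalization of m. -/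
theorem kerr_psi (hq : q ∈ kerrDomain M a) :
    psi0 (kerrMetric M a) q (kerrTetrad M a q) = 0 ∧
    psi1 (kerrMetric M a) q (kerrTetrad M a q) = 0 ∧
    psi2 (kerrMetric M a) q (kerrTetrad M a q) = kerrU M a q + kerrV M a q * Complex.I ∧
    psi3 (kerrMetric M a) q (kerrTetrad M a q) = 0 ∧
    psi4 (kerrMetric M a) q (kerrTetrad M a q) = 0 := by
  have hS : (kSigma a q : ℂ) ≠ 0 := Complex.ofReal_ne_zero.mpr hq.1
  have hD : (kDelta M a q : ℂ) ≠ 0 := Complex.ofReal_ne_zero.mpr hq.2.1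
  have hs : (Real.sin (q 2) : ℂ) ≠ 0 := Complex.ofReal_ne_zero.mpr hq.2.2
  have hm := kerrMu_mul_star a q
  have h0 := kerrCoframeC_mulVec_frame hq 0
  have h1 := kerrCoframeC_mulVec_frame hq 1
  have h2 := kerrCoframeC_mulVec_frame hq 2
  have h3 := kerrCoframeC_mulVec_frame hq 3
  have w := kerr_weylC_frame hq
  have p0 := w 0 2 0 2
  have p1 := w 0 1 0 2
  have p2 := w 0 2 3 1
  have p3 := w 0 1 3 1
  have p4 := w 1 3 1 3
  simp only [kerrTetradComponents, h0, h1, h2, h3, typeDForm_map_mulVec] at p0 p1 p2 p3 p4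
  clear w h0 h1 h2 h3
  generalize kerrMu a q = μ at *
  generalize (kSigma a q : ℂ) = S at *
  generalize (kDelta M a q : ℂ) = D at *
  generalize (Real.sin (q 2) : ℂ) = s at *
  generalize (kerrU M a q : ℂ) = u at *
  generalize (kerrV M a q : ℂ) = v at *
  generalize star μ = ν at *
  field_simp at hm
  simp only [dotProduct, Fin.sum_univ_six, bivec, biv, Fin.isValue, Matrix.cons_val]
    at p0 p1 p2 p3 p4
  refine ⟨(congrArg Neg.neg p0).trans ?_, (congrArg Neg.neg p1).trans ?_,
    (congrArg Neg.neg p2).trans ?_, (congrArg Neg.neg p3).trans ?_, (congrArg Neg.neg p4).trans ?_⟩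
  · clear p0 p1 p2 p3 p4
    field_simp
    ring
  · clear p0 p1 p2 p3 p4
    ring
  · clear p0 p1 p2 p3 p4
    field_simp
    linear_combination 2 * S ^ 2 * D * (u + v * Complex.I) * hm
      - 2 * S ^ 3 * D * u * ν * μ * Complex.I_sq
  · clear p0 p1 p2 p3 p4
    ring
  · clear p0 p1 p2 p3 p4
    field_simp
    ring

end

/-! ### The singular value problem in the frame. -/

section

variable {M a : ℝ} {q : Fin 4 → ℝ}

theorem kerrCoframe_mulVec_injective (hS : kSigma a q ≠ 0) {X Y : Fin 4 → ℝ}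
    (h : kerrCoframe a q *ᵥ X = kerrCoframe a q *ᵥ Y) : X = Y := by
  have := congrArg (kerrFrame a q *ᵥ ·) h
  simpa only [Matrix.mulVec_mulVec, kerrFrame_mul_kerrCoframe hS, Matrix.one_mulVec] using this

theorem kerrEta_mulVec_injective (hq : q ∈ kerrDomain M a) {x y : Fin 4 → ℝ}
    (h : kerrEta M a q *ᵥ x = kerrEta M a q *ᵥ y) : x = y := by
  have := congrArg (Matrix.diagonal (kerrEtaInv M a q) *ᵥ ·) h
  simpa only [Matrix.mulVec_mulVec, kerrEtaInv_mul_kerrEta hq, Matrix.one_mulVec] using this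

/-- An eigenvalue-type equation for the curvature operator, in the frame. -/
theorem kerr_curvOp_eq_smul_iff (hq : q ∈ kerrDomain M a) (W X Y Z : Fin 4 → ℝ) (σ : ℝ) :
    curvOp (kerrMetric M a) q Y Z X = σ • W ↔
      twoForm (kerrForm M a q *ᵥ bivec (kerrCoframe a q *ᵥ Y) (kerrCoframe a q *ᵥ Z))
        *ᵥ (kerrCoframe a q *ᵥ X) = kerrEta M a q *ᵥ (σ • (kerrCoframe a q *ᵥ W)) := by
  rw [← kerr_curvOp hq, ← Matrix.mulVec_smul]
  exact ⟨fun h => by rw [h], fun h => kerrCoframe_mulVec_injective hq.1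
    (kerrEta_mulVec_injective hq h)⟩

/-- The part of the norm of a vector from the first two frame components. -/
def kerrAlpha (M a : ℝ) (q x : Fin 4 → ℝ) : ℝ :=
  -(kDelta M a q / kSigma a q) * x 0 ^ 2 + kSigma a q / kDelta M a q * x 1 ^ 2

/-- The part of the norm of a vector from the last two frame components. -/
def kerrBeta (a : ℝ) (q x : Fin 4 → ℝ) : ℝ :=
  kSigma a q * x 2 ^ 2 + Real.sin (q 2) ^ 2 / kSigma a q * x 3 ^ 2

theorem kerrEta_norm (M a : ℝ) (q x : Fin 4 → ℝ) :
    x ⬝ᵥ kerrEta M a q *ᵥ x = kerrAlpha M a q x + kerrBeta a q x := by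
  simp [kerrEta_eq_diagonal, Matrix.mulVec_diagonal, dotProduct, Fin.sum_univ_four, kerrAlpha,
    kerrBeta]
  ring

/-- Reflection of the last two components. -/
def reflect (x : Fin 4 → ℝ) : Fin 4 → ℝ := ![x 0, x 1, -x 2, -x 3]

theorem kerrAlpha_reflect (M a : ℝ) (q x : Fin 4 → ℝ) :
    kerrAlpha M a q (reflect x) = kerrAlpha M a q x := by
  simp [kerrAlpha, reflect]

theorem kerrBeta_reflect (a : ℝ) (q x : Fin 4 → ℝ) :
    kerrBeta a q (reflect x) = kerrBeta a q x := by
  simp [kerrBeta, reflect]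

theorem reflect_reflect (x : Fin 4 → ℝ) : reflect (reflect x) = x := by
  ext A
  fin_cases A <;> simp [reflect]

/-- With x = P + Q the reflected vector is P - Q, so the bivector is 2 P∧Q and has only mixed
components. The v-terms cancel on contraction with x, and the u-terms collect into the squared norms
of Q and P. -/
theorem kerr_curvature_reflect (hq : q ∈ kerrDomain M a) (x : Fin 4 → ℝ) :
    twoForm (kerrForm M a q *ᵥ bivec (reflect x) x) *ᵥ x
      = kerrEta M a q *ᵥ ![-(2 * kerrU M a q * kerrBeta a q x * x 0),
          -(2 * kerrU M a q * kerrBeta a q x * x 1), 2 * kerrU M a q * kerrAlpha M a q x * x 2,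
          2 * kerrU M a q * kerrAlpha M a q x * x 3] := by
  obtain ⟨hS, hD, hs⟩ := hq
  rw [kerrForm, typeDForm_mulVec, kerrEta_eq_diagonal]
  ext A
  fin_cases A <;>
    simp [-mul_eq_mul_left_iff, -mul_eq_mul_right_iff, twoForm, bivec, biv, reflect, kerrAlpha, kerrBeta, Matrix.mulVec, dotProduct,
      Fin.sum_univ_four] <;>
    field_simp <;> ring

theorem bivec_swap {R : Type*} [CommRing R] (x y : Fin 4 → R) : bivec x y = -bivec y x := by
  ext I
  exact biv_swap I x y

theorem bivec_neg_left {R : Type*} [CommRing R] (x y : Fin 4 → R) :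
    bivec (-x) y = -bivec x y := by
  ext I
  fin_cases I <;> simp [bivec, biv] <;> ring

theorem bivec_neg_right {R : Type*} [CommRing R] (x y : Fin 4 → R) :
    bivec x (-y) = -bivec x y := by
  rw [bivec_swap, bivec_neg_left, neg_neg, bivec_swap]

/-- The singular value problem for `X`, its reflection `Y`, `Z = X` and `W = -Y`. -/
theorem kerr_isSVP_iff (hq : q ∈ kerrDomain M a) {W X Y Z : Fin 4 → ℝ} {σ : ℝ} (hZ : Z = X)
    (hW : W = -Y) (hY : kerrCoframe a q *ᵥ Y = reflect (kerrCoframe a q *ᵥ X)) (hXY : X ≠ Y)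
    (hXY' : X ≠ -Y) :
    IsSVP (kerrMetric M a) q W X Y Z σ ↔
      2 * kerrU M a q * kerrBeta a q (kerrCoframe a q *ᵥ X) = σ ∧
      2 * kerrU M a q * kerrAlpha M a q (kerrCoframe a q *ᵥ X) = σ ∧
      kerrAlpha M a q (kerrCoframe a q *ᵥ X) + kerrBeta a q (kerrCoframe a q *ᵥ X) = 1 := by
  subst hZ hW
  have hneg : kerrCoframe a q *ᵥ (-Y) = -(kerrCoframe a q *ᵥ Y) := Matrix.mulVec_neg _ _
  have c1 := kerr_curvature_reflect hq (kerrCoframe a q *ᵥ Z)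
  have c2 := kerr_curvature_reflect hq (reflect (kerrCoframe a q *ᵥ Z))
  rw [reflect_reflect, kerrAlpha_reflect, kerrBeta_reflect] at c2
  have hnX := kerr_inner4 hq Z Z
  have hnY := kerr_inner4 hq Y Y
  have hnW := kerr_inner4 hq (-Y) (-Y)
  rw [kerrEta_norm] at hnX hnY
  rw [hneg, Matrix.mulVec_neg, dotProduct_neg, neg_dotProduct, neg_neg, kerrEta_norm] at hnW
  rw [hY, kerrAlpha_reflect, kerrBeta_reflect] at hnY hnW
  have e1 := kerr_curvOp_eq_smul_iff hq (-Y) Z Y Z σ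
  have e2 := kerr_curvOp_eq_smul_iff hq Z (-Y) Z Y σ
  have e3 := kerr_curvOp_eq_smul_iff hq Y Z (-Y) Z σ
  have e4 := kerr_curvOp_eq_smul_iff hq Z Y Z (-Y) σ
  rw [hneg, hY] at e1 e2 e3
  rw [hneg, hY] at e4
  -- Vanishing of the first two components would give X = -Y, and of the last two X = Y; both are
  -- excluded.
  have hx01 : ¬ ((kerrCoframe a q *ᵥ Z) 0 = 0 ∧ (kerrCoframe a q *ᵥ Z) 1 = 0) := by
    rintro ⟨h0, h1⟩
    refine hXY' (kerrCoframe_mulVec_injective hq.1 ?_)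
    rw [hneg, hY]
    ext A
    fin_cases A <;> simp [reflect, h0, h1]
  have hx23 : ¬ ((kerrCoframe a q *ᵥ Z) 2 = 0 ∧ (kerrCoframe a q *ᵥ Z) 3 = 0) := by
    rintro ⟨h0, h1⟩
    refine hXY (kerrCoframe_mulVec_injective hq.1 ?_)
    rw [hY]
    ext A
    fin_cases A <;> simp [reflect, h0, h1]
  generalize kerrCoframe a q *ᵥ Z = x at *
  generalize kerrAlpha M a q x = α at *
  generalize kerrBeta a q x = β at *
  generalize kerrU M a q = u at *
  constructor
  · intro h
    -- The first equation of the problem already suffices. Comparing with the components (-x₀, -x₁,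
    -- x₂, x₃) of W, a nonzero component in each plane can be cancelled.
    have h1 := kerrEta_mulVec_injective hq (c1.symm.trans (e1.mp h.eqW))
    have g0 := congrFun h1 0
    have g1 := congrFun h1 1
    have g2 := congrFun h1 2
    have g3 := congrFun h1 3
    simp [reflect] at g0 g1 g2 g3
    refine ⟨?_, ?_, hnX.symm.trans h.normX⟩
    · rcases g0 with h | h0
      · exact h
      · rcases g1 with h | h1
        · exact h
        · exact absurd ⟨h0, h1⟩ hx01
    · rcases g2 with h | h2
      · exact h
      · rcases g3 with h | h3
        · exact h
        · exact absurd ⟨h2, h3⟩ hx23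
  · rintro ⟨h1, h2, h3⟩
    rw [h1, h2] at c1 c2
    -- `k1` is the key identity at x and `k2` at its reflection; all four equations are these two up
    -- to the signs from antisymmetry of R and linearity.
    have k1 : twoForm (kerrForm M a q *ᵥ bivec (reflect x) x) *ᵥ x
        = kerrEta M a q *ᵥ (σ • -reflect x) := by
      rw [c1]; congr 1; ext A; fin_cases A <;> simp [reflect]
    have k2 : twoForm (kerrForm M a q *ᵥ bivec x (reflect x)) *ᵥ reflect x
        = kerrEta M a q *ᵥ (σ • -x) := by
      rw [c2]; congr 1; ext A; fin_cases A <;> simp [reflect]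
    refine ⟨e1.mpr k1, e2.mpr ?_, e3.mpr ?_, e4.mpr ?_, hnW.trans h3, hnX.trans h3, hnY.trans h3,
      hnX.trans h3⟩
    · rw [Matrix.mulVec_neg, k2, smul_neg, Matrix.mulVec_neg, neg_neg]
    · rw [bivec_neg_left, Matrix.mulVec_neg, twoForm_neg, Matrix.neg_mulVec, k1, smul_neg,
        Matrix.mulVec_neg, neg_neg]
    · rw [bivec_neg_right, Matrix.mulVec_neg, twoForm_neg, Matrix.neg_mulVec, k2, smul_neg,
        Matrix.mulVec_neg, neg_neg]

end

/-- Each of the four equations contains W exactly once, so changing its sign is absorbed by changing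
that of σ. -/
theorem IsSVP.neg {g : (Fin 4 → ℝ) → Matrix (Fin 4) (Fin 4) ℝ} {p W X Y Z : Fin 4 → ℝ} {σ : ℝ}
    (h : IsSVP g p W X Y Z σ) : IsSVP g p (-W) X Y Z (-σ) := by
  have h1 : ∀ A B C, curvOp g p A B (-C) = -curvOp g p A B C := by
    intro A B C
    ext i
    simp [curvOp]
  have h2 : ∀ A B C, curvOp g p (-A) B C = -curvOp g p A B C := by
    intro A B C
    ext i
    simp [curvOp]
  have h3 : ∀ A B C, curvOp g p A (-B) C = -curvOp g p A B C := by
    intro A B C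
    ext i
    simp [curvOp]
  refine ⟨?_, ?_, ?_, ?_, ?_, h.normX, h.normY, h.normZ⟩
  · rw [h.eqW, neg_smul_neg]
  · rw [h1, h.eqX, neg_smul]
  · rw [h2, h.eqY, neg_smul]
  · rw [h3, h.eqZ, neg_smul]
  · have := h.normW
    simpa [inner4] using this

/-! ### The ansatz, the singular value and its attainment. -/

section

variable {M a : ℝ} {q : Fin 4 → ℝ}

/-- l, n and m, m̄ span the two planes, so flipping the last two coefficients is the reflection. The
norms follow from ⟨l, n⟩ = -1 and ⟨m, m̄⟩ = 1, all other products being zero. -/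
theorem kerrTetrad_ansatz (hq : q ∈ kerrDomain M a) {c : Fin 4 → ℂ} {W X Y Z : Fin 4 → ℝ}
    (h : (kerrTetrad M a q).Ansatz c W X Y Z) :
    kerrCoframe a q *ᵥ Y = reflect (kerrCoframe a q *ᵥ X) ∧
    (kerrAlpha M a q (kerrCoframe a q *ᵥ X) : ℂ) = -2 * c 0 * c 1 ∧
    (kerrBeta a q (kerrCoframe a q *ᵥ X) : ℂ) = 2 * c 2 * c 3 := by
  have hS : (kSigma a q : ℂ) ≠ 0 := Complex.ofReal_ne_zero.mpr hq.1
  have hD : (kDelta M a q : ℂ) ≠ 0 := Complex.ofReal_ne_zero.mpr hq.2.1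
  have hs : (Real.sin (q 2) : ℂ) ≠ 0 := Complex.ofReal_ne_zero.mpr hq.2.2
  have hm := kerrMu_mul_star a q
  have f0 := kerrCoframeC_mulVec_frame hq 0
  have f1 := kerrCoframeC_mulVec_frame hq 1
  have f2 := kerrCoframeC_mulVec_frame hq 2
  have f3 := kerrCoframeC_mulVec_frame hq 3
  have hX := congrArg (kerrCoframeC a q *ᵥ ·) h.hX
  have hY := congrArg (kerrCoframeC a q *ᵥ ·) h.hY
  simp only [kerrCoframeC_mulVec_toC, Matrix.mulVec_add, Matrix.mulVec_smul, Fin.sum_univ_four, f0,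
    f1, f2, f3] at hX hY
  clear f0 f1 f2 f3
  generalize kerrCoframe a q *ᵥ X = x at *
  generalize kerrCoframe a q *ᵥ Y = y at *
  have x0 := congrFun hX 0
  have x1 := congrFun hX 1
  have x2 := congrFun hX 2
  have x3 := congrFun hX 3
  have y0 := congrFun hY 0
  have y1 := congrFun hY 1
  have y2 := congrFun hY 2
  have y3 := congrFun hY 3
  simp [toC, -Complex.ofReal_sin] at x0 x1 x2 x3 y0 y1 y2 y3
  refine ⟨?_, ?_, ?_⟩
  · ext A
    fin_cases A <;> simp only [Fin.zero_eta, Fin.mk_one, Fin.reduceFinMk, Fin.isValue, reflect,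
      Matrix.cons_val] <;> apply Complex.ofReal_injective
    · rw [x0, y0]
    · rw [x1, y1]
    · rw [Complex.ofReal_neg, x2, y2]; ring
    · rw [Complex.ofReal_neg, x3, y3]; ring
  · simp only [kerrAlpha, Complex.ofReal_add, Complex.ofReal_mul, Complex.ofReal_neg,
      Complex.ofReal_div, Complex.ofReal_pow, x0, x1]
    field_simp
    ring
  · simp only [kerrBeta, Complex.ofReal_add, Complex.ofReal_mul, Complex.ofReal_div,
      Complex.ofReal_pow, x2, x3]
    rw [Complex.star_def] at hm
    generalize kerrMu a q = μ at *
    generalize (starRingEnd ℂ) μ = ν at *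
    generalize (kSigma a q : ℂ) = S at *
    generalize (Real.sin (q 2) : ℂ) = s at *
    field_simp at hm ⊢
    linear_combination 2 * c 2 * c 3 * hm + S * (c 2 * μ - c 3 * ν) ^ 2 * Complex.I_sq

theorem kerr_psi2_add_star (hq : q ∈ kerrDomain M a) :
    psi2 (kerrMetric M a) q (kerrTetrad M a q) + star (psi2 (kerrMetric M a) q (kerrTetrad M a q))
      = ((2 * kerrU M a q : ℝ) : ℂ) := by
  rw [(kerr_psi hq).2.2.1]
  simp only [Complex.star_def, map_add, map_mul, Complex.conj_ofReal, Complex.conj_I,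
    Complex.ofReal_mul, Complex.ofReal_ofNat]
  ring

theorem kerr_isSVP_iff_psi2 (hq : q ∈ kerrDomain M a) {c : Fin 4 → ℂ} {W X Y Z : Fin 4 → ℝ} {σ : ℝ}
    (h : (kerrTetrad M a q).Ansatz c W X Y Z) (hXY : X ≠ Y) (hXY' : X ≠ -Y) :
    IsSVP (kerrMetric M a) q W X Y Z σ ↔
      2 * c 2 * c 3 * (psi2 (kerrMetric M a) q (kerrTetrad M a q)
        + star (psi2 (kerrMetric M a) q (kerrTetrad M a q))) - σ = 0 ∧
      2 * c 0 * c 1 * (psi2 (kerrMetric M a) q (kerrTetrad M a q)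
        + star (psi2 (kerrMetric M a) q (kerrTetrad M a q))) + σ = 0 ∧
      -2 * c 0 * c 1 + 2 * c 2 * c 3 = 1 := by
  obtain ⟨hY, hα, hβ⟩ := kerrTetrad_ansatz hq h
  have hα' : 2 * c 0 * c 1 = -(kerrAlpha M a q (kerrCoframe a q *ᵥ X) : ℂ) := by rw [hα]; ring
  rw [kerr_isSVP_iff hq h.hZ h.hW hY hXY hXY', kerr_psi2_add_star hq, ← hα, ← hβ, hα']
  norm_cast
  refine and_congr ?_ (and_congr ?_ Iff.rfl)
  · rw [sub_eq_zero, mul_comm]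
  · rw [neg_mul, neg_add_eq_zero, mul_comm]

/-- Adding 2uβ = σ and 2uα = σ and using α + β = 1 gives 2u = 2σ; this remains valid when u = 0,
where α and β are not determined separately. -/
theorem kerr_singularValue_eq (hq : q ∈ kerrDomain M a) {c : Fin 4 → ℂ} {W X Y Z : Fin 4 → ℝ}
    {σ : ℝ} (h : (kerrTetrad M a q).Ansatz c W X Y Z) (hXY : X ≠ Y) (hXY' : X ≠ -Y)
    (hσ : IsSVP (kerrMetric M a) q W X Y Z σ) : σ = kerrU M a q := by
  obtain ⟨h1, h2, h3⟩ :=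
    (kerr_isSVP_iff hq h.hZ h.hW (kerrTetrad_ansatz hq h).1 hXY hXY').mp hσ
  linear_combination -(1 / 2) * h1 - 1 / 2 * h2 + kerrU M a q * h3

theorem kerr_invI (hq : q ∈ kerrDomain M a) :
    invI (kerrMetric M a) q (kerrTetrad M a q)
      = 3 * ((kerrU M a q : ℂ) + kerrV M a q * Complex.I) ^ 2 := by
  obtain ⟨h0, h1, h2, h3, h4⟩ := kerr_psi hq
  rw [invI, h0, h1, h2]
  ring

/-- |I| = 3(u² + v²) and Re I = 3(u² - v²), so v drops out of the sum 6u². -/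
theorem kerr_sqrt_invI (hq : q ∈ kerrDomain M a) :
    Real.sqrt ((‖invI (kerrMetric M a) q (kerrTetrad M a q)‖
      + (invI (kerrMetric M a) q (kerrTetrad M a q)).re) / 6) = |kerrU M a q| := by
  have hn : ‖(kerrU M a q : ℂ) + kerrV M a q * Complex.I‖ ^ 2
      = kerrU M a q ^ 2 + kerrV M a q ^ 2 := by
    rw [← Complex.normSq_eq_norm_sq, Complex.normSq_add_mul_I]
  have hr : (3 * ((kerrU M a q : ℂ) + kerrV M a q * Complex.I) ^ 2).re
      = 3 * (kerrU M a q ^ 2 - kerrV M a q ^ 2) := by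
    simp [pow_two]
  rw [kerr_invI hq, hr, norm_mul, norm_pow, hn, ← Real.sqrt_sq_eq_abs, Complex.norm_ofNat]
  congr 1
  ring

theorem kerr_exists_ansatz (hq : q ∈ kerrDomain M a) :
    ∃ (c : Fin 4 → ℂ) (W X Y Z : Fin 4 → ℝ), (kerrTetrad M a q).Ansatz c W X Y Z ∧ X ≠ Y ∧
      X ≠ -Y ∧ IsSVP (kerrMetric M a) q W X Y Z (kerrU M a q) := by
  set T := kerrTetrad M a q with hT
  set V : Fin 4 → ℝ := fun i => (T.m i).re with hV
  set X : Fin 4 → ℝ := (1 / 2 : ℝ) • T.l - (1 / 2 : ℝ) • T.n + V with hX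
  set Y : Fin 4 → ℝ := (1 / 2 : ℝ) • T.l - (1 / 2 : ℝ) • T.n - V with hY
  -- The coefficients are chosen so that -2x¹x² = 2x³x⁴ = 1/2, splitting the unit norm equally
  -- between the planes; x³ and x⁴ are conjugate, so X is real.
  have hA : T.Ansatz ![1 / 2, -(1 / 2), 1 / 2, 1 / 2] (-Y) X Y X := by
    have hre : ∀ i, ((T.m i).re : ℂ) = (T.m i + star (T.m i)) / 2 := fun i => by
      rw [Complex.re_eq_add_conj, Complex.star_def]
    refine ⟨?_, ?_, rfl, rfl⟩
    · ext i
      simp [toC, hX, hV, Fin.sum_univ_four, Tetrad.frame, hre]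
      ring
    · ext i
      simp [toC, hY, hV, Fin.sum_univ_four, Tetrad.frame, hre]
      ring
  obtain ⟨hr, hα, hβ⟩ := kerrTetrad_ansatz hq hA
  have hα' : kerrAlpha M a q (kerrCoframe a q *ᵥ X) = 1 / 2 := by
    apply Complex.ofReal_injective
    rw [hα]
    simp
  have hβ' : kerrBeta a q (kerrCoframe a q *ᵥ X) = 1 / 2 := by
    apply Complex.ofReal_injective
    rw [hβ]
    simp
  have hXY : X ≠ Y := by
    intro h
    rw [← h] at hr
    have h2 := congrFun hr 2
    have h3 := congrFun hr 3
    simp only [reflect, Fin.isValue, Matrix.cons_val, self_eq_neg] at h2 h3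
    rw [kerrBeta, h2, h3] at hβ'
    norm_num at hβ'
  have hXY' : X ≠ -Y := by
    intro h
    rw [show Y = -X by rw [h, neg_neg], Matrix.mulVec_neg] at hr
    have h0 := congrFun hr 0
    have h1 := congrFun hr 1
    simp only [reflect, Fin.isValue, Matrix.cons_val, Pi.neg_apply, neg_eq_self] at h0 h1
    rw [kerrAlpha, h0, h1] at hα'
    norm_num at hα'
  refine ⟨_, _, X, Y, X, hA, hXY, hXY', (kerr_isSVP_iff hq rfl rfl hr hXY hXY').mpr ?_⟩
  rw [hα', hβ']
  refine ⟨by ring, by ring, by norm_num⟩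

theorem kerrU_eq (M a : ℝ) (q : Fin 4 → ℝ) :
    kerrU M a q = (q 1 ^ 3 - 3 * q 1 * a ^ 2 * Real.cos (q 2) ^ 2) * M
      / (q 1 ^ 2 + a ^ 2 * Real.cos (q 2) ^ 2) ^ 3 := by
  rw [kerrU, kSigma]
  ring

theorem kerrU_schwarzschild (M : ℝ) (q : Fin 4 → ℝ) : kerrU M 0 q = M / q 1 ^ 3 := by
  rw [kerrU, kSigma]
  -- At r = 0 both sides are zero by the convention for division by zero.
  rcases eq_or_ne (q 1) 0 with h | h
  · simp [h]
  · field_simp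
    ring

theorem kerrU_nonneg
    (h : 0 ≤ (q 1 ^ 3 - 3 * q 1 * a ^ 2 * Real.cos (q 2) ^ 2) * M) : 0 ≤ kerrU M a q := by
  rw [kerrU_eq]
  positivity

end

end

end KerrSVP

theorem mainTheorem9 (M a : ℝ) (p : Fin 4 → ℝ) (hS : kSigma a p ≠ 0) (hD : kDelta M a p ≠ 0)
    (hs : Real.sin (p 2) ≠ 0) :
    -- the vectors form a Newman–Penrose null tetrad
    (kerrTetrad M a p).IsNull (kerrMetric M a) p ∧
    -- the Weyl scalars
    psi0 (kerrMetric M a) p (kerrTetrad M a p) = 0 ∧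
    psi1 (kerrMetric M a) p (kerrTetrad M a p) = 0 ∧
    psi2 (kerrMetric M a) p (kerrTetrad M a p) =
      (M : ℂ) / ((p 1 : ℂ) - Complex.I * a * Real.cos (p 2)) ^ 3 ∧
    psi3 (kerrMetric M a) p (kerrTetrad M a p) = 0 ∧
    psi4 (kerrMetric M a) p (kerrTetrad M a p) = 0 ∧
    -- under the ansatz the singular value problem reduces to two equations and a normalization
    (∀ (c : Fin 4 → ℂ) (W X Y Z : Fin 4 → ℝ) (σ : ℝ),
      (kerrTetrad M a p).Ansatz c W X Y Z → X ≠ Y → X ≠ -Y →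
      (IsSVP (kerrMetric M a) p W X Y Z σ ↔
        2 * c 2 * c 3 * (psi2 (kerrMetric M a) p (kerrTetrad M a p)
          + star (psi2 (kerrMetric M a) p (kerrTetrad M a p))) - σ = 0 ∧
        2 * c 0 * c 1 * (psi2 (kerrMetric M a) p (kerrTetrad M a p)
          + star (psi2 (kerrMetric M a) p (kerrTetrad M a p))) + σ = 0 ∧
        -2 * c 0 * c 1 + 2 * c 2 * c 3 = 1)) ∧
    -- the singular value given by the ansatz
    (∀ (c : Fin 4 → ℂ) (W X Y Z : Fin 4 → ℝ) (σ : ℝ),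
      (kerrTetrad M a p).Ansatz c W X Y Z → X ≠ Y → X ≠ -Y →
      IsSVP (kerrMetric M a) p W X Y Z σ →
      σ = (p 1 ^ 3 - 3 * p 1 * a ^ 2 * Real.cos (p 2) ^ 2) * M
            / (p 1 ^ 2 + a ^ 2 * Real.cos (p 2) ^ 2) ^ 3 ∧
      |σ| = Real.sqrt ((‖invI (kerrMetric M a) p (kerrTetrad M a p)‖
              + (invI (kerrMetric M a) p (kerrTetrad M a p)).re) / 6) ∧
      (0 ≤ (p 1 ^ 3 - 3 * p 1 * a ^ 2 * Real.cos (p 2) ^ 2) * M →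
        σ = Real.sqrt ((‖invI (kerrMetric M a) p (kerrTetrad M a p)‖
              + (invI (kerrMetric M a) p (kerrTetrad M a p)).re) / 6)) ∧
      (a = 0 → σ = M / p 1 ^ 3)) ∧
    -- it is attained
    (∃ (c : Fin 4 → ℂ) (W X Y Z : Fin 4 → ℝ),
      (kerrTetrad M a p).Ansatz c W X Y Z ∧ X ≠ Y ∧ X ≠ -Y ∧
      IsSVP (kerrMetric M a) p W X Y Z
        ((p 1 ^ 3 - 3 * p 1 * a ^ 2 * Real.cos (p 2) ^ 2) * M
            / (p 1 ^ 2 + a ^ 2 * Real.cos (p 2) ^ 2) ^ 3) ∧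
      -- up to the sign of `W`, so is the nonnegative root
      (IsSVP (kerrMetric M a) p W X Y Z
          (Real.sqrt ((‖invI (kerrMetric M a) p (kerrTetrad M a p)‖
              + (invI (kerrMetric M a) p (kerrTetrad M a p)).re) / 6)) ∨
        IsSVP (kerrMetric M a) p (-W) X Y Z
          (Real.sqrt ((‖invI (kerrMetric M a) p (kerrTetrad M a p)‖
              + (invI (kerrMetric M a) p (kerrTetrad M a p)).re) / 6)))) ∧
    -- the Schwarzschild case
    (a = 0 → invI (kerrMetric M a) p (kerrTetrad M a p) = 3 * (M : ℂ) ^ 2 / (p 1 : ℂ) ^ 6) := by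
  have hq : p ∈ kerrDomain M a := ⟨hS, hD, hs⟩
  obtain ⟨h0, h1, h2, h3, h4⟩ := kerr_psi hq
  refine ⟨kerrTetrad_isNull hq, h0, h1, h2.trans (kerrU_add_kerrV_mul_I M hS), h3, h4,
    fun c W X Y Z σ hA hXY hXY' => kerr_isSVP_iff_psi2 hq hA hXY hXY', ?_, ?_, ?_⟩
  · intro c W X Y Z σ hA hXY hXY' hσ
    rw [kerr_sqrt_invI hq, kerr_singularValue_eq hq hA hXY hXY' hσ]
    refine ⟨kerrU_eq M a p, rfl, fun h => (abs_of_nonneg (kerrU_nonneg h)).symm, ?_⟩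
    rintro rfl
    exact kerrU_schwarzschild M p
  · obtain ⟨c, W, X, Y, Z, hA, hXY, hXY', hσ⟩ := kerr_exists_ansatz hq
    refine ⟨c, W, X, Y, Z, hA, hXY, hXY', kerrU_eq M a p ▸ hσ, ?_⟩
    rw [kerr_sqrt_invI hq]
    -- The root is |u|: when it equals -u, the vector -W realizes it.
    rcases abs_choice (kerrU M a p) with h | h
    · exact Or.inl (h.symm ▸ hσ)
    · exact Or.inr (h.symm ▸ hσ.neg)
  · rintro rfl
    rw [kerr_invI hq, kerrU_schwarzschild]
    simp [kerrV]
    ring
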